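/- \textbf{Setting.} A transmitter with $M\ge 1$ antennas serves $K=gG$ single-antenna users, divided into $G$ groups of $g$ users, $1\le G<K$; $\mathcal K_i=\{(i-1)g+1,\dots,ig\}$ is group $i$. User $k$ has channel $\mathbf h_k\in\mathbb C^M$ and the transmitter uses precoders $\mathbf p_1,\dots,\mathbf p_K\in\mathbb C^M$ with $\sum_k\|\mathbf p_k\|^2\le P$. With unit-variance noise, user $j\in\mathcal K_i$ decodes the streams $k\in\mathcal K_i$, $k\ge j$, by successive interference cancellation at the rates $$R_{j,k}=\log_2\Bigl(1+\frac{|\mathbf h_j^H\mathbf p_k|^2}{\sum_{m<k,\,m\in\mathcal K_i}|\mathbf h_j^H\mathbf p_m|^2+\sum_{m\notin\mathcal K_i}|\mathbf h_j^H\mathbf p_m|^2+1}\Bigr).$$ \textbf{Imperfect CSIT of quality $\alpha\in[0,1]$.} The receivers know their channels; the transmitter knows only the estimates $\hat{\mathbf h}_k$ in $\mathbf h_k=\hat{\mathbf h}_k+\tilde{\mathbf h}_k$, where at SNR $P>1$ we have $\hat{\mathbf h}_k=\sqrt{1-\sigma_e^2}\,\mathbf a_k$, $\tilde{\mathbf h}_k=\sigma_e\mathbf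 b_k$, $\sigma_e^2=P^{-\alpha}$. Here $\mathbf a_k,\mathbf b_k$ have zero mean, are uncorrelated, and $\mathbb E\|\mathbf a_k\|^2=\mathbb E\|\mathbf b_k\|^2=\Gamma_k\in(0,\infty)$, so that $\mathbb E\|\hat{\mathbf h}_k\|^2=(1-\sigma_e^2)\Gamma_k$ and $\mathbb E\|\tilde{\mathbf h}_k\|^2=\sigma_e^2\Gamma_k$. The joint law of all $(\mathbf a_k,\mathbf b_k)_{k\le K}$ may depend on $P$ and is absolutely continuous with respect to Lebesgue measure, uniformly in $P$: for every $\varepsilon>0$ there is $\delta>0$ such that for all $P>1$ every Borel set of Lebesgue measure at most $\delta$ has probability at most $\varepsilon$. (Any fixed joint law with a density, for instance i.i.d. complex Gaussian entries, is allowed.) \textbf{Max-min fair (MMF) rate.} A scheme at power $P$ is a measurable map $\hat{\mathbf H}=[\hat{\mathbf h}_1\ \dots\ \hat{\mathbf h}_K]\mapsto(\mathbf p_1,\dots,\mathbf p_K)$ obeying the power constraint for every $\hat{\mathbf H}$. The average rate of user $k\in\mathcal K_i$ given the estimates is $R_k(\hat{\mathbf H})=\min_{j\le k,\,j\in\mathcal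 K_i}\mathbb E[R_{j,k}\mid\hat{\mathbf H}]$. Transmission is one-shot, without time-sharing, so the (ergodic) MMF rate of the scheme is $\mathbb E_{\hat{\mathbf H}}[\min_kR_k(\hat{\mathbf H})]$. Let $R_{\mathrm{mmf}}(P)$ be the supremum of the MMF rates over all schemes at power $P$. The MMF multiplexing gain is $d_{\mathrm{mmf}}=\lim_{P\to\infty}R_{\mathrm{mmf}}(P)/\log_2P$. \textbf{Proposition.} The limit exists and $$d_{\mathrm{mmf}}=\begin{cases}\alpha/g,&G>1\text{ and }M\ge K-g+1,\\0,&G>1\text{ and }M<K-g+1,\\1/K,&G=1.\end{cases}$$ Moreover, if $G>1$ and $M\ge K-g+1$, the gain $\alpha/g$ is achieved by zero-forcing on the channel estimates: there are a constant $c>0$ and schemes for all $P>1$ in which almost surely $\hat{\mathbf h}_j^H\mathbf p_m=0$ whenever users $j$ and $m$ are in different groups, and in which the $k$-th user of every group ($k=1,\dots,g$) has power $\|\mathbf p\|^2=c\,P^{1-(g-k)\alpha/g}$, such that the ratio of their MMF rate to $\log_2P$ tends to $\alpha/g$. -/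

import Mathlib

open MeasureTheory ProbabilityTheory Filter Topology
open scoped ENNReal Matrix

namespace NOMA

/-- Users: `(i, r)` is the `r`-th user (counted from `0`) of group `i`; there are `G` groups of `g`
users each. The user `(i, 0)` is the strong user of group `i`. -/
abbrev User (G g : ℕ) : Type := Fin G × Fin g

/-- A vector of `ℂ^M` for every user: either all channel vectors `h_k`, or all precoders `p_k`. -/
abbrev Vectors (M G g : ℕ) : Type := User G g → Fin M → ℂ

/-- The squared `l₂`-norm `‖v‖²`. -/
noncomputable def sqNorm {M : ℕ} (v : Fin M → ℂ) : ℝ := ∑ a, ‖v a‖ ^ 2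

/-- The received power `|hᴴ p|²`. -/
noncomputable def gain {M : ℕ} (h p : Fin M → ℂ) : ℝ := ‖star h ⬝ᵥ p‖ ^ 2

/-- Interference from the streams of the same group that are decoded after stream `k`, at user `j`
(used for `j`, `k` in the same group). -/
noncomputable def intraInterference {M G g : ℕ} (H p : Vectors M G g) (j k : User G g) : ℝ :=
  ∑ m : User G g with m.1 = j.1 ∧ m.2 < k.2, gain (H j) (p m)

/-- Interference at user `j` from all the streams of the other groups. -/
noncomputable def interInterference {M G g : ℕ} (H p : Vectors M G g) (j : User G g) : ℝ :=
  ∑ m : User G g with m.1 ≠ j.1, gain (H j) (p m)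

/-- The rate `R_{j,k}` (bits per channel use) at which user `j` can decode the stream of user `k`
of the same group by successive interference cancellation, for channels `H` and precoders `p`;
the noise has unit variance. -/
noncomputable def rate {M G g : ℕ} (H p : Vectors M G g) (j k : User G g) : ℝ :=
  Real.logb 2 (1 + gain (H j) (p k) / (intraInterference H p j k + interInterference H p j + 1))

/-- A linear precoding scheme at power `P`: the precoders are a (measurable) function of the channel
estimates only, and they obey the power constraint for all channel estimates. -/
structure IsScheme {M G g : ℕ} (P : ℝ) (p : Vectors M G g → Vectors M G g) : Prop where
  measurable : Measurable p
  power_le : ∀ Hhat, ∑ k, sqNorm (p Hhat k) ≤ P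

/-- The class of fading laws. For each SNR `P`, `ν P` is the joint law of the pair (normalized
channel estimates, normalized estimation errors) of all users: both have zero mean and average power
`Γ k`, they are uncorrelated, and their joint laws are absolutely continuous with respect to Lebesgue
measure, uniformly in `P`. The laws may depend on `P`, and users may be dependent. -/
structure IsFadingModel {M G g : ℕ} (Γ : User G g → ℝ)
    (ν : ℝ → Measure (Vectors M G g × Vectors M G g)) : Prop where
  power_pos : ∀ k, 0 < Γ k
  estimate_mean : ∀ P > 1, ∀ k a, ∫ ω, ω.1 k a ∂ν P = 0
  error_mean : ∀ P > 1, ∀ k a, ∫ ω, ω.2 k a ∂ν P = 0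
  estimate_power : ∀ P > 1, ∀ k, ∫⁻ ω, ENNReal.ofReal (sqNorm (ω.1 k)) ∂ν P = ENNReal.ofReal (Γ k)
  error_power : ∀ P > 1, ∀ k, ∫⁻ ω, ENNReal.ofReal (sqNorm (ω.2 k)) ∂ν P = ENNReal.ofReal (Γ k)
  uncorrelated : ∀ P > 1, ∀ k a b, ∫ ω, ω.1 k a * star (ω.2 k b) ∂ν P = 0
  uniformly_ac : ∀ ε : ℝ≥0∞, 0 < ε → ∃ δ : ℝ≥0∞, 0 < δ ∧ ∀ P > 1,
    ∀ W : Set (Vectors M G g × Vectors M G g), MeasurableSet W → volume W ≤ δ → ν P W ≤ ε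

/-- The normalized variance `σ_e² = P^{-α}` of the estimation error at SNR `P`. -/
noncomputable def errVar (α P : ℝ) : ℝ := P ^ (-α)

/-- The pair (channel estimates `Ĥ`, channels `H = Ĥ + H̃`) at SNR `P` and CSIT quality `α`, obtained
from the pair of normalized estimates and normalized errors. -/
noncomputable def channelPair {M G g : ℕ} (α P : ℝ) (ω : Vectors M G g × Vectors M G g) :
    Vectors M G g × Vectors M G g :=
  (fun k a => (√(1 - errVar α P) : ℂ) * ω.1 k a,
   fun k a => (√(1 - errVar α P) : ℂ) * ω.1 k a + (√(errVar α P) : ℂ) * ω.2 k a)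

/-- The joint law of (channel estimates, channels) at SNR `P` and CSIT quality `α`. -/
noncomputable def jointLaw {M G g : ℕ} (α : ℝ) (ν : ℝ → Measure (Vectors M G g × Vectors M G g))
    (P : ℝ) : Measure (Vectors M G g × Vectors M G g) :=
  (ν P).map (channelPair α P)

instance {M G g : ℕ} (α : ℝ) (ν : ℝ → Measure (Vectors M G g × Vectors M G g))
    [∀ P, IsProbabilityMeasure (ν P)] (P : ℝ) : IsProbabilityMeasure (jointLaw α ν P) :=
  Measure.isProbabilityMeasure_map (by unfold channelPair; fun_prop)

section Rates

variable {M G g : ℕ} (J : Measure (Vectors M G g × Vectors M G g)) [IsFiniteMeasure J]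

/-- The conditional expectation of `R_{j,k}` given the channel estimates `Hhat`, when `J` is the
joint law of (channel estimates, channels). -/
noncomputable def avgRate (p : Vectors M G g → Vectors M G g) (Hhat : Vectors M G g)
    (j k : User G g) : ℝ≥0∞ :=
  ∫⁻ H, ENNReal.ofReal (rate H (p Hhat) j k) ∂(J.condKernel Hhat)

/-- The average rate of user `k` given the channel estimates: stream `k` is decoded by all the users
of its group that come before `k`, and by `k` itself. -/
noncomputable def userRate (p : Vectors M G g → Vectors M G g) (Hhat : Vectors M G g)
    (k : User G g) : ℝ≥0∞ :=
  ⨅ r : Fin g, ⨅ _ : r ≤ k.2, avgRate J p Hhat (k.1, r) k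

/-- The ergodic max-min fair rate of the scheme `p`. Transmission is one-shot (no time-sharing): the
minimum over the users is taken for each realization of the channel estimates. -/
noncomputable def mmfRate (p : Vectors M G g → Vectors M G g) : ℝ≥0∞ :=
  ∫⁻ Hhat, ⨅ k, userRate J p Hhat k ∂J.fst

/-- The largest ergodic max-min fair rate at power `P`. -/
noncomputable def optMmfRate (P : ℝ) : ℝ≥0∞ :=
  ⨆ p : Vectors M G g → Vectors M G g, ⨆ _ : IsScheme P p, mmfRate J p

end Rates

/-- `lim_{P → ∞} R(P) / log₂ P = d`. -/
def HasMultiplexingGain (R : ℝ → ℝ≥0∞) (d : ℝ) : Prop :=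
  Tendsto (fun P : ℝ => R P / ENNReal.ofReal (Real.logb 2 P)) atTop (𝓝 (ENNReal.ofReal d))

/-- The precoders `p` (a function of the channel estimates, whose law is `L`) are zero-forcing on the
estimates: the precoders of each group are orthogonal to the estimated channels of all the users of
the other groups. -/
def IsZeroForcing {M G g : ℕ} (L : Measure (Vectors M G g)) (p : Vectors M G g → Vectors M G g) :
    Prop :=
  ∀ᵐ Hhat ∂L, ∀ k j : User G g, j.1 ≠ k.1 → star (Hhat j) ⬝ᵥ p Hhat k = 0

end NOMA

/-!
All statements are for SNR `P → ∞`, with rates measured against `log₂ P`.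

**Converse.** Given the channel estimates, the precoders are fixed, and the rate of the worst user
can be bounded through any user chosen as a function of the estimates. The strong user of a group
decodes all the streams of that group, and its `g` rates telescope to the rate
`log₂ (1 + S / (I + 1))` of the superposed signal (`sum_rate_eq`), where `S` is the received power
of the group and `I` the interference from the other groups.

* With one group, `S ≤ ‖h‖² P` and `I = 0`, so the worst of the `g = K` rates is at most
  `(log₂ P) / K + O(1)` on average.
* With several groups, take a group that does not contain the strongest stream `p_m`. The precoder
  `p_m` depends on the estimates only, so that a change of the estimation error, which has variance
  `σ_e² = P^{-α}`, changes the channel but not `p_m`. Hence `I ≥ δ P^{-α} ‖p_m‖²` except on an event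
  of small probability, and off this event the worst rate is at most `(α / g) log₂ P + O(1)`. On the
  exceptional event the trivial bound `log₂ P + O(1)` suffices. This holds for any number of
  antennas.
* If moreover `M ≤ K - g` and `α > 0`, the estimated channels of the users outside of the group of
  the strongest stream span `ℂ^M`, so one of those users receives `p_m` with power of order
  `‖p_m‖²`, and its own rate is bounded.

**Achievability.** All streams of a group share one unit vector, orthogonal to the estimated
channels of the other groups, and have powers growing by the factor `P^{β/g}` from one stream to the next. On
an event of probability close to `1`, each stream has a signal-to-interference ratio of order
`P^{β/g}` at all its decoders, provided that the interference from the other groups is `O(P^{1-β})`: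
this holds with `β = α` for zero-forcing (where only the error component interferes), and with
`β = 1` for a single group.

**Small balls.** The probabilistic input is that the exceptional events have small probability
*uniformly* in `P` and in the precoders, although the fading laws may depend on `P` and all that is
known about their shape is uniform absolute continuity. The events are sets that meet every complex
line of a suitable direction (a coordinate of the error or of the estimate of one user) in a small
disc. By Fubini's theorem and tightness such sets have small Lebesgue measure up to a set of small
probability (`exists_measure_le_of_sections`, `exists_measure_gain_lt`).
-/

namespace NOMA

variable {M G g : ℕ}

/-! ### Norms, gains and rates -/

lemma sqNorm_nonneg (v : Fin M → ℂ) : 0 ≤ sqNorm v :=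
  Finset.sum_nonneg fun _ _ => sq_nonneg _

lemma sqNorm_smul (c : ℂ) (v : Fin M → ℂ) : sqNorm (c • v) = ‖c‖ ^ 2 * sqNorm v := by
  simp [sqNorm, Finset.mul_sum, mul_pow]

lemma sqNorm_eq_zero {v : Fin M → ℂ} : sqNorm v = 0 ↔ v = 0 := by
  unfold sqNorm
  rw [Finset.sum_eq_zero_iff_of_nonneg fun _ _ => sq_nonneg _]
  simp [funext_iff]

lemma norm_sq_le_sqNorm (v : Fin M → ℂ) (a : Fin M) : ‖v a‖ ^ 2 ≤ sqNorm v :=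
  Finset.single_le_sum (f := fun a => ‖v a‖ ^ 2) (fun _ _ => sq_nonneg _) (Finset.mem_univ a)

lemma sqNorm_add_le (v w : Fin M → ℂ) : sqNorm (v + w) ≤ 2 * (sqNorm v + sqNorm w) := by
  unfold sqNorm
  rw [← Finset.sum_add_distrib, Finset.mul_sum]
  refine Finset.sum_le_sum fun a _ => ?_
  have h := norm_add_le (v a) (w a)
  have h0 := norm_nonneg (v a + w a)
  rw [Pi.add_apply]
  nlinarith [sq_nonneg (‖v a‖ - ‖w a‖)]

lemma exists_sqNorm_le (hM : 1 ≤ M) (v : Fin M → ℂ) : ∃ a, sqNorm v ≤ M * ‖v a‖ ^ 2 := by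
  have : Nonempty (Fin M) := ⟨⟨0, hM⟩⟩
  obtain ⟨a, ha⟩ := Finite.exists_max fun a => ‖v a‖ ^ 2
  refine ⟨a, (Finset.sum_le_card_nsmul Finset.univ _ _ fun b _ => ha b).trans_eq ?_⟩
  simp

lemma gain_nonneg (h p : Fin M → ℂ) : 0 ≤ gain h p := sq_nonneg _

lemma gain_smul (c : ℂ) (h p : Fin M → ℂ) : gain h (c • p) = ‖c‖ ^ 2 * gain h p := by
  simp [gain, dotProduct_smul, mul_pow]

lemma gain_smul_left (c : ℂ) (h p : Fin M → ℂ) : gain (c • h) p = ‖c‖ ^ 2 * gain h p := by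
  simp [gain, star_smul, smul_dotProduct, mul_pow]

/-- The Cauchy–Schwarz inequality. -/
lemma gain_le (h p : Fin M → ℂ) : gain h p ≤ sqNorm h * sqNorm p := by
  have h1 : ‖star h ⬝ᵥ p‖ ≤ ∑ a, ‖h a‖ * ‖p a‖ :=
    (norm_sum_le _ _).trans_eq (Finset.sum_congr rfl fun a _ => by simp)
  exact (pow_le_pow_left₀ (norm_nonneg _) h1 2).trans (Finset.sum_mul_sq_le_sq_mul_sq _ _ _)

lemma gain_add_le (h h' p : Fin M → ℂ) : gain (h + h') p ≤ 2 * (gain h p + gain h' p) := by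
  unfold gain
  rw [star_add, add_dotProduct]
  have hn := norm_add_le (star h ⬝ᵥ p) (star h' ⬝ᵥ p)
  nlinarith [sq_nonneg (‖star h ⬝ᵥ p‖ - ‖star h' ⬝ᵥ p‖), norm_nonneg (star h ⬝ᵥ p + star h' ⬝ᵥ p)]

lemma intraInterference_nonneg (H p : Vectors M G g) (j k : User G g) :
    0 ≤ intraInterference H p j k :=
  Finset.sum_nonneg fun _ _ => gain_nonneg _ _

lemma interInterference_nonneg (H p : Vectors M G g) (j : User G g) :
    0 ≤ interInterference H p j :=
  Finset.sum_nonneg fun _ _ => gain_nonneg _ _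

lemma rate_nonneg (H p : Vectors M G g) (j k : User G g) : 0 ≤ rate H p j k := by
  have h1 := intraInterference_nonneg H p j k
  have h2 := interInterference_nonneg H p j
  refine Real.logb_nonneg one_lt_two ?_
  have := gain_nonneg (H j) (p k)
  have : 0 ≤ gain (H j) (p k) / (intraInterference H p j k + interInterference H p j + 1) := by
    positivity
  linarith

lemma intraInterference_eq (H p : Vectors M G g) (j : User G g) (r : Fin g) :
    intraInterference H p j (j.1, r) = ∑ s with s < r, gain (H j) (p (j.1, s)) := by
  unfold intraInterference
  refine Finset.sum_nbij' (fun m => m.2) (fun s => (j.1, s)) ?_ ?_ ?_ ?_ ?_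
  · intro m hm; simpa using (Finset.mem_filter.1 hm).2.2
  · intro s hs; simpa using hs
  · intro m hm
    have := (Finset.mem_filter.1 hm).2.1
    exact Prod.ext this.symm rfl
  · intro s _; rfl
  · intro m hm
    have := (Finset.mem_filter.1 hm).2.1
    rw [← this]

lemma sum_logb_telescope {n : ℕ} (x : Fin n → ℝ) (hx : ∀ r, 0 ≤ x r) {c : ℝ} (hc : 0 < c) :
    ∑ r, Real.logb 2 (1 + x r / (∑ s with s < r, x s + c)) =
      Real.logb 2 (1 + (∑ r, x r) / c) := by
  induction n with
  | zero => simp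
  | succ n ih =>
    rw [Fin.sum_univ_castSucc, Fin.sum_univ_castSucc (f := x)]
    have h1 : ∀ r : Fin n, ∑ s with s < r.castSucc, x s = ∑ s with s < r, x s.castSucc := by
      intro r
      rw [Finset.sum_filter, Finset.sum_filter, Fin.sum_univ_castSucc]
      simp [(Fin.castSucc_lt_last r).not_gt]
    have h2 : ∑ s with s < Fin.last n, x s = ∑ s : Fin n, x s.castSucc := by
      rw [Finset.sum_filter, Fin.sum_univ_castSucc]
      simp [Fin.castSucc_lt_last]
    simp_rw [h1]
    rw [ih (fun r => x r.castSucc) fun r => hx _, h2]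
    have hS : 0 ≤ ∑ s : Fin n, x s.castSucc := Finset.sum_nonneg fun s _ => hx _
    have hl := hx (Fin.last n)
    rw [← Real.logb_mul (by positivity) (by positivity)]
    congr 1
    field_simp
    ring

/-- Successive decoding is lossless: the rates at which a user decodes all the streams of its own
group add up to the rate of their superposition. -/
lemma sum_rate_eq (H p : Vectors M G g) (j : User G g) :
    ∑ r, rate H p j (j.1, r) =
      Real.logb 2 (1 + (∑ r, gain (H j) (p (j.1, r))) / (interInterference H p j + 1)) := by
  have h := interInterference_nonneg H p j
  rw [← sum_logb_telescope (fun r => gain (H j) (p (j.1, r))) (fun r => gain_nonneg _ _)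
    (show 0 < interInterference H p j + 1 by linarith)]
  refine Finset.sum_congr rfl fun r _ => ?_
  rw [rate, intraInterference_eq, add_assoc]

@[fun_prop]
lemma measurable_sqNorm : Measurable (sqNorm : (Fin M → ℂ) → ℝ) := by unfold sqNorm; fun_prop

@[fun_prop]
lemma _root_.Measurable.sqNorm {X : Type*} [MeasurableSpace X] {f : X → Fin M → ℂ}
    (hf : Measurable f) : Measurable fun x => NOMA.sqNorm (f x) := measurable_sqNorm.comp hf

@[fun_prop]
lemma _root_.Measurable.gain {X : Type*} [MeasurableSpace X] {f p : X → Fin M → ℂ}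
    (hf : Measurable f) (hp : Measurable p) : Measurable fun x => NOMA.gain (f x) (p x) := by
  simp only [NOMA.gain, dotProduct, Pi.star_apply]
  have h1 : ∀ a, Measurable fun x => f x a := fun a => (measurable_pi_apply a).comp hf
  have h2 : ∀ a, Measurable fun x => p x a := fun a => (measurable_pi_apply a).comp hp
  have h3 : ∀ a, Measurable fun x => star (f x a) := fun a =>
    continuous_star.measurable.comp (h1 a)
  fun_prop

lemma _root_.Measurable.rate {X : Type*} [MeasurableSpace X] {H p : X → Vectors M G g}
    (hH : Measurable H) (hp : Measurable p) (j k : User G g) :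
    Measurable fun x => NOMA.rate (H x) (p x) j k := by
  have h1 : ∀ k, Measurable fun x => H x k := fun a => (measurable_pi_apply a).comp hH
  have h2 : ∀ k, Measurable fun x => p x k := fun a => (measurable_pi_apply a).comp hp
  simp only [NOMA.rate, Real.logb, intraInterference, interInterference]
  fun_prop

/-- The total power of the vectors of all the users. -/
noncomputable def energy (H : Vectors M G g) : ℝ := ∑ k, sqNorm (H k)

lemma energy_nonneg (H : Vectors M G g) : 0 ≤ energy H :=
  Finset.sum_nonneg fun _ _ => sqNorm_nonneg _

lemma sqNorm_le_energy (H : Vectors M G g) (k : User G g) : sqNorm (H k) ≤ energy H :=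
  Finset.single_le_sum (f := fun k => sqNorm (H k)) (fun _ _ => sqNorm_nonneg _)
    (Finset.mem_univ k)

lemma measurable_energy : Measurable (energy : Vectors M G g → ℝ) := by
  unfold energy
  have h1 : ∀ k, Measurable fun H : Vectors M G g => H k := fun k => measurable_pi_apply k
  fun_prop

lemma norm_sq_le_energy (H : Vectors M G g) : ‖H‖ ^ 2 ≤ energy H := by
  have h : ‖H‖ ≤ √(energy H) := by
    refine (pi_norm_le_iff_of_nonneg (Real.sqrt_nonneg _)).2 fun k =>
      (pi_norm_le_iff_of_nonneg (Real.sqrt_nonneg _)).2 fun a => ?_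
    exact Real.le_sqrt_of_sq_le ((norm_sq_le_sqNorm _ a).trans (sqNorm_le_energy H k))
  calc ‖H‖ ^ 2 ≤ √(energy H) ^ 2 := pow_le_pow_left₀ (norm_nonneg _) h 2
    _ = energy H := Real.sq_sqrt (energy_nonneg H)

/-! ### Uniform smallness of exceptional events -/

section Instances

-- Instance search on this product of function spaces exceeds the default size bound.
set_option synthInstance.maxSize 1000

instance : MeasurableAdd (Vectors M G g × Vectors M G g) := inferInstance

instance : SFinite (volume : Measure (Vectors M G g × Vectors M G g)) := inferInstance

instance : (volume : Measure (Vectors M G g × Vectors M G g)).IsAddHaarMeasure :=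
  Measure.prod.instIsAddHaarMeasure _ _

end Instances

section Fading

variable {Γ : User G g → ℝ} {ν : ℝ → Measure (Vectors M G g × Vectors M G g)}

lemma lintegral_energy_eq (hν : IsFadingModel Γ ν) {P : ℝ} (hP : 1 < P) :
    ∫⁻ ω, ENNReal.ofReal (energy ω.1 + energy ω.2) ∂ν P = ENNReal.ofReal (2 * ∑ k, Γ k) := by
  have hm1 : ∀ k, Measurable fun ω : Vectors M G g × Vectors M G g =>
      ENNReal.ofReal (sqNorm (ω.1 k)) := fun k =>
    (measurable_sqNorm.comp ((measurable_pi_apply k).comp measurable_fst)).ennreal_ofReal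
  have hm2 : ∀ k, Measurable fun ω : Vectors M G g × Vectors M G g =>
      ENNReal.ofReal (sqNorm (ω.2 k)) := fun k =>
    (measurable_sqNorm.comp ((measurable_pi_apply k).comp measurable_snd)).ennreal_ofReal
  have hΓ : 0 ≤ ∑ k, Γ k := Finset.sum_nonneg fun k _ => (hν.power_pos k).le
  simp_rw [ENNReal.ofReal_add (energy_nonneg _) (energy_nonneg _), energy,
    ENNReal.ofReal_sum_of_nonneg fun k (_ : k ∈ Finset.univ) => sqNorm_nonneg _]
  rw [lintegral_add_left (Finset.measurable_sum _ fun k _ => hm1 k),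
    lintegral_finsetSum _ fun k _ => hm1 k, lintegral_finsetSum _ fun k _ => hm2 k]
  simp_rw [hν.estimate_power P hP, hν.error_power P hP]
  rw [← ENNReal.ofReal_sum_of_nonneg fun k _ => (hν.power_pos k).le, two_mul,
    ENNReal.ofReal_add hΓ hΓ]

/-- The fading laws are uniformly tight. -/
lemma exists_energy_bound (hν : IsFadingModel Γ ν) {ε : ℝ≥0∞} (hε : 0 < ε) :
    ∃ R : ℝ, 0 < R ∧ ∀ P > 1, ν P {ω | R < energy ω.1 + energy ω.2} ≤ ε := by
  obtain ⟨ε', hε', hεε⟩ := ENNReal.lt_iff_exists_nnreal_btwn.1 hε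
  have hε0 : (0 : ℝ) < ε' := by exact_mod_cast hε'
  have hΓ : 0 ≤ ∑ k, Γ k := Finset.sum_nonneg fun k _ => (hν.power_pos k).le
  refine ⟨(2 * ∑ k, Γ k + 1) / ε', by positivity, fun P hP => ?_⟩
  set R := (2 * ∑ k, Γ k + 1) / ε' with hR
  have hR0 : 0 < R := by positivity
  have h1 := mul_meas_ge_le_lintegral (μ := ν P)
    (f := fun ω : Vectors M G g × Vectors M G g => ENNReal.ofReal (energy ω.1 + energy ω.2))
    ((measurable_energy.comp measurable_fst).add
      (measurable_energy.comp measurable_snd)).ennreal_ofReal (ENNReal.ofReal R)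
  rw [lintegral_energy_eq hν hP] at h1
  have h2 : ENNReal.ofReal (2 * ∑ k, Γ k) ≤ ENNReal.ofReal R * ε' := by
    rw [← ENNReal.ofReal_coe_nnreal (p := ε'), ← ENNReal.ofReal_mul hR0.le]
    refine ENNReal.ofReal_le_ofReal ?_
    rw [hR, div_mul_cancel₀ _ hε0.ne']
    linarith
  refine (measure_mono fun ω hω => ?_).trans (((ENNReal.mul_le_mul_iff_right
    (by simpa using hR0) ENNReal.ofReal_ne_top).1 (h1.trans h2)).trans hεε.le)
  exact ENNReal.ofReal_le_ofReal (le_of_lt hω)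

lemma energy_subset_closedBall (R : ℝ) :
    {ω : Vectors M G g × Vectors M G g | energy ω.1 + energy ω.2 ≤ R} ⊆
      Metric.closedBall 0 (√R) := by
  intro ω hω
  have h1 := norm_sq_le_energy ω.1
  have h2 := norm_sq_le_energy ω.2
  have h3 := energy_nonneg ω.1
  have h4 := energy_nonneg ω.2
  have hω' : energy ω.1 + energy ω.2 ≤ R := hω
  rw [mem_closedBall_zero_iff]
  exact max_le (Real.le_sqrt_of_sq_le (by linarith)) (Real.le_sqrt_of_sq_le (by linarith))

/-- Fubini's theorem in the direction `e`: a set in a ball of radius `R` whose intersections with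
the complex lines of direction `e` have measure at most `δ` has measure at most a constant times
`δ`. The constant comes from averaging over the translates by the multiples `z • e`, `‖z‖ ≤ 1`. -/
lemma volume_mul_le_of_sections (e : Vectors M G g × Vectors M G g) (R : ℝ)
    {S : Set (Vectors M G g × Vectors M G g)} (hS : MeasurableSet S)
    (hSR : S ⊆ Metric.closedBall 0 R) {δ : ℝ≥0∞}
    (hδ : ∀ y, volume {z : ℂ | y + z • e ∈ S} ≤ δ) :
    volume (Metric.closedBall (0 : ℂ) 1) * volume S ≤
      δ * volume (Metric.closedBall (0 : Vectors M G g × Vectors M G g) (R + ‖e‖)) := by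
  set D := Metric.closedBall (0 : ℂ) 1
  set B := Metric.closedBall (0 : Vectors M G g × Vectors M G g) (R + ‖e‖)
  have hT : Measurable fun q : ℂ × (Vectors M G g × Vectors M G g) => q.2 + q.1 • e := by
    fun_prop
  have hm : Measurable fun q : ℂ × (Vectors M G g × Vectors M G g) =>
      S.indicator (1 : Vectors M G g × Vectors M G g → ℝ≥0∞) (q.2 + q.1 • e) :=
    (measurable_one.indicator hS).comp hT
  calc volume D * volume S
      = ∫⁻ z in D, ∫⁻ y, S.indicator (1 : Vectors M G g × Vectors M G g → ℝ≥0∞) (y + z • e) := by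
        have : ∀ z : ℂ, ∫⁻ y, S.indicator (1 : Vectors M G g × Vectors M G g → ℝ≥0∞) (y + z • e) =
            volume S := by
          intro z
          rw [lintegral_add_right_eq_self
            (fun y => S.indicator (1 : Vectors M G g × Vectors M G g → ℝ≥0∞) y),
            lintegral_indicator_one hS]
        simp_rw [this]
        rw [setLIntegral_const, mul_comm]
    _ = ∫⁻ y, ∫⁻ z in D, S.indicator (1 : Vectors M G g × Vectors M G g → ℝ≥0∞) (y + z • e) :=
        lintegral_lintegral_swap hm.aemeasurable
    _ ≤ ∫⁻ y, B.indicator (fun _ => δ) y := by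
        refine lintegral_mono fun y => ?_
        by_cases hy : y ∈ B
        · rw [Set.indicator_of_mem hy]
          refine (setLIntegral_le_lintegral _ _).trans ?_
          have hms : MeasurableSet {z : ℂ | y + z • e ∈ S} :=
            hS.preimage (by fun_prop : Measurable fun z : ℂ => y + z • e)
          have : (fun z : ℂ => S.indicator (1 : Vectors M G g × Vectors M G g → ℝ≥0∞) (y + z • e)) =
              {z : ℂ | y + z • e ∈ S}.indicator 1 := rfl
          rw [this, lintegral_indicator_one hms]
          exact hδ y
        · rw [Set.indicator_of_notMem hy, nonpos_iff_eq_zero]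
          refine setLIntegral_eq_zero Metric.isClosed_closedBall.measurableSet fun z hz => ?_
          refine Set.indicator_of_notMem (fun h => hy ?_) _
          have h1 : ‖y + z • e‖ ≤ R := by simpa using hSR h
          have h2 : ‖z‖ ≤ 1 := by simpa [D] using hz
          have h3 : ‖y‖ ≤ ‖y + z • e‖ + ‖z • e‖ := by
            simpa using norm_sub_le (y + z • e) (z • e)
          rw [norm_smul] at h3
          have h4 := mul_le_of_le_one_left (norm_nonneg e) h2
          simpa [B] using (by linarith : ‖y‖ ≤ R + ‖e‖)
    _ = δ * volume B := lintegral_indicator_const Metric.isClosed_closedBall.measurableSet _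

/-- A set whose sections by the complex lines of a fixed direction are uniformly small has small
probability, uniformly in the SNR. -/
lemma exists_measure_le_of_sections (hν : IsFadingModel Γ ν)
    (e : Vectors M G g × Vectors M G g) {ε : ℝ≥0∞} (hε : 0 < ε) :
    ∃ δ : ℝ≥0∞, 0 < δ ∧ ∀ P > 1, ∀ S, MeasurableSet S →
      (∀ y, volume {z : ℂ | y + z • e ∈ S} ≤ δ) → ν P S ≤ ε := by
  obtain ⟨R, -, hR⟩ := exists_energy_bound hν (ENNReal.half_pos hε.ne')
  obtain ⟨η, hη, hηW⟩ := hν.uniformly_ac (ε / 2) (ENNReal.half_pos hε.ne')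
  set D := Metric.closedBall (0 : ℂ) 1
  set B := Metric.closedBall (0 : Vectors M G g × Vectors M G g) (√R + ‖e‖)
  have hD0 : volume D ≠ 0 := (Metric.measure_closedBall_pos _ _ one_pos).ne'
  have hDt : volume D ≠ ⊤ := measure_closedBall_lt_top.ne
  have hBt : volume B ≠ ⊤ := measure_closedBall_lt_top.ne
  refine ⟨volume D * η / (volume B + 1), ?_, fun P hP S hS hSδ => ?_⟩
  · exact ENNReal.div_pos (mul_ne_zero hD0 hη.ne') (by simp [hBt])
  · set E := {ω : Vectors M G g × Vectors M G g | energy ω.1 + energy ω.2 ≤ R}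
    have hE : MeasurableSet E :=
      measurableSet_le ((measurable_energy.comp measurable_fst).add
        (measurable_energy.comp measurable_snd)) measurable_const
    have h1 := volume_mul_le_of_sections e (√R) (hS.inter hE)
      (Set.inter_subset_right.trans (energy_subset_closedBall R))
      (fun y => (measure_mono fun z hz => hz.1).trans (hSδ y))
    have h2 : volume (S ∩ E) ≤ η := by
      refine (ENNReal.mul_le_mul_iff_right hD0 hDt).1 (h1.trans ?_)
      calc volume D * η / (volume B + 1) * volume B
          ≤ volume D * η / (volume B + 1) * (volume B + 1) := by gcongr; exact le_self_add
        _ ≤ volume D * η := by rw [mul_comm]; exact ENNReal.mul_div_le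
    calc ν P S ≤ ν P (S ∩ E ∪ {ω | R < energy ω.1 + energy ω.2}) := by
          refine measure_mono fun ω hω => ?_
          rcases le_or_gt (energy ω.1 + energy ω.2) R with h | h
          · exact Or.inl ⟨hω, h⟩
          · exact Or.inr h
      _ ≤ ε / 2 + ε / 2 :=
          (measure_union_le _ _).trans
            (add_le_add (hηW P hP _ (hS.inter hE) h2) (hR P hP))
      _ = ε := ENNReal.add_halves ε

/-- A random variable that does not depend on the SNR is bounded in probability, uniformly in the
SNR. -/
lemma exists_bound_of_measurable (hν : IsFadingModel Γ ν)
    {N : Vectors M G g × Vectors M G g → ℝ} (hN : Measurable N) {ε : ℝ≥0∞} (hε : 0 < ε) :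
    ∃ R : ℝ, 0 < R ∧ ∀ P > 1, ν P {ω | R < N ω} ≤ ε := by
  obtain ⟨R, -, hR⟩ := exists_energy_bound hν (ENNReal.half_pos hε.ne')
  obtain ⟨η, hη, hηW⟩ := hν.uniformly_ac (ε / 2) (ENNReal.half_pos hε.ne')
  set E := {ω : Vectors M G g × Vectors M G g | energy ω.1 + energy ω.2 ≤ R}
  have hE : MeasurableSet E :=
    measurableSet_le ((measurable_energy.comp measurable_fst).add
      (measurable_energy.comp measurable_snd)) measurable_const
  have hEt : volume E ≠ ⊤ :=
    ((measure_mono (energy_subset_closedBall R)).trans_lt measure_closedBall_lt_top).ne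
  have hS : ∀ n : ℕ, MeasurableSet {ω | (n : ℝ) < N ω} := fun n =>
    measurableSet_lt measurable_const hN
  have hlim : Tendsto (fun n : ℕ => volume ({ω | (n : ℝ) < N ω} ∩ E)) atTop (𝓝 0) := by
    have h := tendsto_measure_iInter_atTop (μ := volume)
      (s := fun n : ℕ => {ω | (n : ℝ) < N ω} ∩ E)
      (fun n => ((hS n).inter hE).nullMeasurableSet)
      (fun m n hmn ω hω => ⟨show (m : ℝ) < N ω from
        lt_of_le_of_lt (by exact_mod_cast hmn) (show (n : ℝ) < N ω from hω.1), hω.2⟩)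
      ⟨0, measure_ne_top_of_subset Set.inter_subset_right hEt⟩
    have h0 : ⋂ n : ℕ, ({ω | (n : ℝ) < N ω} ∩ E) = ∅ := by
      refine Set.eq_empty_of_forall_notMem fun ω hω => ?_
      obtain ⟨n, hn⟩ := exists_nat_gt (N ω)
      exact absurd (Set.mem_iInter.1 hω n).1 (not_lt.2 hn.le)
    rwa [h0, measure_empty] at h
  obtain ⟨n, hn0, hn⟩ := ((eventually_gt_atTop 0).and (hlim.eventually (gt_mem_nhds hη))).exists
  refine ⟨n, by exact_mod_cast hn0, fun P hP => ?_⟩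
  calc ν P {ω | (n : ℝ) < N ω}
      ≤ ν P ({ω | (n : ℝ) < N ω} ∩ E ∪ {ω | R < energy ω.1 + energy ω.2}) := by
        refine measure_mono fun ω hω => ?_
        rcases le_or_gt (energy ω.1 + energy ω.2) R with h | h
        · exact Or.inl ⟨hω, h⟩
        · exact Or.inr h
    _ ≤ ε / 2 + ε / 2 :=
        (measure_union_le _ _).trans
          (add_le_add (hηW P hP _ ((hS n).inter hE) hn.le) (hR P hP))
    _ = ε := ENNReal.add_halves ε

lemma measure_eq_zero_of_volume (hν : IsFadingModel Γ ν)
    {W : Set (Vectors M G g × Vectors M G g)} (hW : MeasurableSet W) (h0 : volume W = 0)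
    {P : ℝ} (hP : 1 < P) : ν P W = 0 := by
  refine le_antisymm (le_of_forall_gt_imp_ge_of_dense fun ε hε => ?_) (zero_le)
  obtain ⟨δ, -, h⟩ := hν.uniformly_ac ε hε
  exact h P hP W hW (by simp [h0])

/-- A small-ball estimate, uniform in the SNR and in the random vectors `x` and `w`: if a shift of
the fading along some direction moves `x` along each coordinate axis at speed `τ` and leaves `w`
unchanged, then `x` is unlikely to be almost orthogonal to `w`. -/
lemma exists_measure_gain_lt (hM : 1 ≤ M) (hν : IsFadingModel Γ ν)
    (e : Fin M → Vectors M G g × Vectors M G g) {ε : ℝ≥0∞} (hε : 0 < ε) :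
    ∃ δ : ℝ, 0 < δ ∧ ∀ P > 1, ∀ x w : Vectors M G g × Vectors M G g → Fin M → ℂ,
      Measurable x → Measurable w → ∀ τ : ℝ, 0 < τ →
      (∀ ω a (z : ℂ), x (ω + z • e a) = x ω + (τ * z) • Pi.single a 1) →
      (∀ ω a (z : ℂ), w (ω + z • e a) = w ω) →
      ν P {ω | gain (x ω) (w ω) < δ * τ ^ 2 * sqNorm (w ω)} ≤ ε := by
  have hM0 : (0 : ℝ) < M := by exact_mod_cast hM
  have hεM : 0 < ε / M := ENNReal.div_pos hε.ne' (ENNReal.natCast_ne_top M)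
  choose η hη hηS using fun a => exists_measure_le_of_sections hν (e a) hεM
  -- `δ` is such that the discs of radius `√(δ * M)` are small enough for every axis.
  obtain ⟨ρ, hρ, hρη⟩ : ∃ ρ : ℝ, 0 < ρ ∧ ∀ a, volume (Metric.ball (0 : ℂ) ρ) ≤ η a := by
    have hlim : Tendsto (fun ρ : ℝ => volume (Metric.ball (0 : ℂ) ρ)) (𝓝[>] 0) (𝓝 0) := by
      simp_rw [Complex.volume_ball]
      have : Tendsto (fun ρ : ℝ => ENNReal.ofReal ρ ^ 2 * (NNReal.pi : ℝ≥0∞)) (𝓝 0)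
          (𝓝 (ENNReal.ofReal 0 ^ 2 * (NNReal.pi : ℝ≥0∞))) :=
        ENNReal.Tendsto.mul_const (ENNReal.Tendsto.pow (ENNReal.continuous_ofReal.tendsto 0))
          (Or.inr ENNReal.coe_ne_top)
      simpa using this.mono_left nhdsWithin_le_nhds
    have h1 : ∀ᶠ ρ : ℝ in 𝓝[>] 0, ∀ a, volume (Metric.ball (0 : ℂ) ρ) ≤ η a :=
      eventually_all.2 fun a => (hlim.eventually (gt_mem_nhds (hη a))).mono fun _ h => h.le
    obtain ⟨ρ, h, h0⟩ := (h1.and self_mem_nhdsWithin).exists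
    exact ⟨ρ, h0, h⟩
  refine ⟨ρ ^ 2 / M, by positivity, fun P hP x w hx hw τ hτ hxe hwe => ?_⟩
  have hmeas : ∀ a, MeasurableSet {ω | gain (x ω) (w ω) < ρ ^ 2 * τ ^ 2 * ‖w ω a‖ ^ 2} := by
    intro a
    have : Measurable fun ω => w ω a := (measurable_pi_apply a).comp hw
    exact measurableSet_lt (hx.gain hw) (by fun_prop)
  have hsec : ∀ a, ν P {ω | gain (x ω) (w ω) < ρ ^ 2 * τ ^ 2 * ‖w ω a‖ ^ 2} ≤ ε / M := by
    intro a
    refine hηS a P hP _ (hmeas a) fun y => ?_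
    by_cases hw0 : w y a = 0
    · have : {z : ℂ | y + z • e a ∈ {ω | gain (x ω) (w ω) < ρ ^ 2 * τ ^ 2 * ‖w ω a‖ ^ 2}} = ∅ := by
        refine Set.eq_empty_of_forall_notMem fun z hz => ?_
        simp only [Set.mem_ofPred_eq, hwe, hw0] at hz
        have := gain_nonneg (x (y + z • e a)) (w y)
        simp at hz
        linarith
      rw [this, measure_empty]
      exact zero_le
    · -- On a complex line, `star (x ω) ⬝ᵥ w ω` is an affine function of `conj z`.
      set b : ℂ := star ((star (x y) ⬝ᵥ w y) / (τ * w y a))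
      refine (measure_mono (t := Metric.ball (-b) ρ) fun z hz => ?_).trans ?_
      · simp only [Set.mem_ofPred_eq, hwe, hxe] at hz
        have hτ0 : (τ : ℂ) ≠ 0 := by exact_mod_cast hτ.ne'
        have h1 : star (x y + (τ * z) • Pi.single a 1) ⬝ᵥ w y =
            (τ * w y a) * star (z + b) := by
          have : star ((τ * z) • (Pi.single a 1 : Fin M → ℂ)) ⬝ᵥ w y = τ * star z * w y a := by
            rw [star_smul, smul_dotProduct, ← Pi.single_star, single_dotProduct]
            simp
          rw [star_add, add_dotProduct, this, star_add]
          simp only [b, star_star]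
          field_simp
          ring
        rw [gain, h1, norm_mul, norm_mul, norm_star, Complex.norm_real, Real.norm_eq_abs,
          abs_of_pos hτ] at hz
        have h2 : 0 < τ * ‖w y a‖ := mul_pos hτ (norm_pos_iff.2 hw0)
        have h3 : (τ * ‖w y a‖ * ‖z + b‖) ^ 2 < (τ * ‖w y a‖ * ρ) ^ 2 := by
          refine hz.trans_eq ?_; ring
        have h4 := lt_of_pow_lt_pow_left₀ 2 (by positivity) h3
        simpa [dist_eq_norm] using lt_of_mul_lt_mul_left h4 h2.le
      · rw [Complex.volume_ball, ← Complex.volume_ball 0]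
        exact hρη a
  calc ν P {ω | gain (x ω) (w ω) < ρ ^ 2 / M * τ ^ 2 * sqNorm (w ω)}
      ≤ ν P (⋃ a, {ω | gain (x ω) (w ω) < ρ ^ 2 * τ ^ 2 * ‖w ω a‖ ^ 2}) := by
        refine measure_mono fun ω hω => ?_
        obtain ⟨a, ha⟩ := exists_sqNorm_le hM (w ω)
        refine Set.mem_iUnion.2 ⟨a, ?_⟩
        refine lt_of_lt_of_le (show gain (x ω) (w ω) < _ from hω) ?_
        calc ρ ^ 2 / M * τ ^ 2 * sqNorm (w ω) ≤ ρ ^ 2 / M * τ ^ 2 * (M * ‖w ω a‖ ^ 2) := by gcongr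
          _ = ρ ^ 2 * τ ^ 2 * ‖w ω a‖ ^ 2 := by field_simp
    _ ≤ ∑ a : Fin M, ν P {ω | gain (x ω) (w ω) < ρ ^ 2 * τ ^ 2 * ‖w ω a‖ ^ 2} :=
        measure_iUnion_fintype_le _ _
    _ ≤ ∑ _a : Fin M, ε / M := Finset.sum_le_sum fun a _ => hsec a
    _ ≤ ε := by
        rw [Finset.sum_const, Finset.card_univ, Fintype.card_fin, nsmul_eq_mul]
        exact ENNReal.mul_div_le

end Fading

/-! ### The joint law of estimates and channels -/

section Channel

variable {α P : ℝ}

lemma errVar_pos (α : ℝ) (hP : 1 < P) : 0 < errVar α P := Real.rpow_pos_of_pos (by linarith) _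

lemma errVar_le_one (hα : 0 ≤ α) (hP : 1 < P) : errVar α P ≤ 1 :=
  Real.rpow_le_one_of_one_le_of_nonpos hP.le (by linarith)

lemma measurable_channelPair (α P : ℝ) :
    Measurable (channelPair α P : Vectors M G g × Vectors M G g → _) := by
  unfold channelPair; fun_prop

lemma channelPair_fst (α P : ℝ) (ω : Vectors M G g × Vectors M G g) :
    (channelPair α P ω).1 = (√(1 - errVar α P) : ℂ) • ω.1 := rfl

lemma channelPair_snd_apply (α P : ℝ) (ω : Vectors M G g × Vectors M G g) (j : User G g) :
    (channelPair α P ω).2 j = (√(1 - errVar α P) : ℂ) • ω.1 j + (√(errVar α P) : ℂ) • ω.2 j := rfl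

lemma channelPair_sub (α P : ℝ) (ω : Vectors M G g × Vectors M G g) (j : User G g) :
    (channelPair α P ω).2 j - (channelPair α P ω).1 j = (√(errVar α P) : ℂ) • ω.2 j := by
  rw [channelPair_snd_apply, channelPair_fst, Pi.smul_apply, add_sub_cancel_left]

lemma norm_sqrt_sq {x : ℝ} (hx : 0 ≤ x) : ‖(√x : ℂ)‖ ^ 2 = x := by
  rw [Complex.norm_real, Real.norm_eq_abs, sq_abs, Real.sq_sqrt hx]

lemma sqNorm_channelPair_sub (hP : 1 < P) (ω : Vectors M G g × Vectors M G g)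
    (j : User G g) :
    sqNorm ((channelPair α P ω).2 j - (channelPair α P ω).1 j) = errVar α P * sqNorm (ω.2 j) := by
  rw [channelPair_sub, sqNorm_smul, norm_sqrt_sq (errVar_pos α hP).le]

lemma energy_channelPair_le (hα : 0 ≤ α) (hP : 1 < P) (ω : Vectors M G g × Vectors M G g) :
    energy (channelPair α P ω).2 ≤ 2 * (energy ω.1 + energy ω.2) := by
  unfold energy
  rw [← Finset.sum_add_distrib, Finset.mul_sum]
  refine Finset.sum_le_sum fun j _ => ?_
  have h0 := (errVar_pos α hP).le
  have h1 := errVar_le_one hα hP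
  rw [channelPair_snd_apply]
  refine (sqNorm_add_le _ _).trans ?_
  rw [sqNorm_smul, sqNorm_smul, norm_sqrt_sq h0, norm_sqrt_sq (by linarith)]
  have ha := sqNorm_nonneg (ω.1 j)
  have hb := sqNorm_nonneg (ω.2 j)
  nlinarith

/-- Shifting the normalized error of user `j`. -/
lemma channelPair_add_error (α P : ℝ) (ω : Vectors M G g × Vectors M G g) (j : User G g)
    (a : Fin M) (z : ℂ) :
    (channelPair α P (ω + z • ((0, Pi.single j (Pi.single a 1)) :
      Vectors M G g × Vectors M G g))).1 = (channelPair α P ω).1 ∧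
    (channelPair α P (ω + z • ((0, Pi.single j (Pi.single a 1)) :
      Vectors M G g × Vectors M G g))).2 j =
      (channelPair α P ω).2 j + ((√(errVar α P) : ℝ) * z) • Pi.single a 1 := by
  constructor
  · simp [channelPair_fst]
  · rw [channelPair_snd_apply, channelPair_snd_apply]
    simp [smul_add, smul_smul, add_assoc]

/-- Shifting the normalized estimate of user `j`. -/
lemma channelPair_add_estimate (α P : ℝ) (ω : Vectors M G g × Vectors M G g) (j : User G g)
    (a : Fin M) (z : ℂ) :
    (∀ k ≠ j, (channelPair α P (ω + z • ((Pi.single j (Pi.single a 1), 0) :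
      Vectors M G g × Vectors M G g))).1 k = (channelPair α P ω).1 k) ∧
    (channelPair α P (ω + z • ((Pi.single j (Pi.single a 1), 0) :
      Vectors M G g × Vectors M G g))).2 j =
      (channelPair α P ω).2 j + ((√(1 - errVar α P) : ℝ) * z) • Pi.single a 1 := by
  constructor
  · intro k hk
    simp [channelPair_fst, Pi.single_eq_of_ne hk]
  · rw [channelPair_snd_apply, channelPair_snd_apply]
    simp [smul_add, smul_smul]
    abel

variable {Γ : User G g → ℝ} {ν : ℝ → Measure (Vectors M G g × Vectors M G g)}

lemma jointLaw_apply (α P : ℝ) {W : Set (Vectors M G g × Vectors M G g)} (hW : MeasurableSet W) :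
    jointLaw α ν P W = ν P {ω | channelPair α P ω ∈ W} :=
  Measure.map_apply (measurable_channelPair α P) hW

lemma lintegral_energy_channel_le (hν : IsFadingModel Γ ν) (hα : 0 ≤ α) (hP : 1 < P) :
    ∫⁻ x, ENNReal.ofReal (energy x.2) ∂jointLaw α ν P ≤ ENNReal.ofReal (4 * ∑ k, Γ k) := by
  have hme : Measurable fun x : Vectors M G g × Vectors M G g => ENNReal.ofReal (energy x.2) :=
    (measurable_energy.comp measurable_snd).ennreal_ofReal
  rw [jointLaw, lintegral_map hme (measurable_channelPair α P)]
  calc ∫⁻ ω, ENNReal.ofReal (energy (channelPair α P ω).2) ∂ν P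
      ≤ ∫⁻ ω, ENNReal.ofReal 2 * ENNReal.ofReal (energy ω.1 + energy ω.2) ∂ν P := by
        refine lintegral_mono fun ω => ?_
        rw [← ENNReal.ofReal_mul zero_le_two]
        exact ENNReal.ofReal_le_ofReal (energy_channelPair_le hα hP ω)
    _ = ENNReal.ofReal (4 * ∑ k, Γ k) := by
        rw [lintegral_const_mul' _ _ ENNReal.ofReal_ne_top, lintegral_energy_eq hν hP,
          ← ENNReal.ofReal_mul zero_le_two]
        ring_nf

lemma measure_iUnion_le_of_le {X ι : Type*} [MeasurableSpace X] [Fintype ι] (μ : Measure X)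
    (S : ι → Set X) {ε : ℝ≥0∞} (h : ∀ i, μ (S i) ≤ ε / Fintype.card ι) : μ (⋃ i, S i) ≤ ε := by
  refine (measure_iUnion_fintype_le μ S).trans
    ((Finset.sum_le_card_nsmul _ _ _ fun i _ => h i).trans ?_)
  rw [Finset.card_univ, nsmul_eq_mul]
  exact ENNReal.mul_div_le

/-- However the precoders depend on the estimates, the error of the estimates makes every user `j`
receive every stream `m` with power at least of the order of `σ_e² ‖p_m‖²`, with high
probability. -/
lemma exists_measure_gain_precoder_lt (hM : 1 ≤ M) (hν : IsFadingModel Γ ν) (α : ℝ)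
    {ε : ℝ≥0∞} (hε : 0 < ε) :
    ∃ δ : ℝ, 0 < δ ∧ ∀ P > 1, ∀ p : Vectors M G g → Vectors M G g, Measurable p →
      jointLaw α ν P (⋃ q : User G g × User G g,
        {x | gain (x.2 q.1) (p x.1 q.2) < δ * errVar α P * sqNorm (p x.1 q.2)}) ≤ ε := by
  have hε' : 0 < ε / (Fintype.card (User G g × User G g) : ℝ≥0∞) :=
    ENNReal.div_pos hε.ne' (ENNReal.natCast_ne_top _)
  choose δ hδ h using fun q : User G g × User G g => exists_measure_gain_lt hM hν
    (fun a => (0, Pi.single q.1 (Pi.single a 1))) hε'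
  obtain ⟨δ₀, hδ₀, hle⟩ : ∃ δ₀ : ℝ, 0 < δ₀ ∧ ∀ q, δ₀ ≤ δ q := by
    obtain hq | hq := isEmpty_or_nonempty (User G g × User G g)
    · exact ⟨1, one_pos, fun q => hq.elim q⟩
    · obtain ⟨q, hq⟩ := Finite.exists_min δ
      exact ⟨δ q, hδ q, hq⟩
  refine ⟨δ₀, hδ₀, fun P hP p hp => measure_iUnion_le_of_le _ _ fun q => ?_⟩
  have hm1 : Measurable fun x : Vectors M G g × Vectors M G g => x.2 q.1 := by fun_prop
  have hm2 : Measurable fun x : Vectors M G g × Vectors M G g => p x.1 q.2 :=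
    (measurable_pi_apply q.2).comp (hp.comp measurable_fst)
  have hσ := errVar_pos α hP
  rw [jointLaw_apply α P (measurableSet_lt (hm1.gain hm2) (hm2.sqNorm.const_mul _))]
  refine (measure_mono fun ω hω => ?_).trans (h q P hP (fun ω => (channelPair α P ω).2 q.1)
    (fun ω => p (channelPair α P ω).1 q.2) (hm1.comp (measurable_channelPair α P))
    (hm2.comp (measurable_channelPair α P)) (√(errVar α P)) (Real.sqrt_pos.2 hσ)
    (fun ω a z => (channelPair_add_error α P ω q.1 a z).2)
    (fun ω a z => by simp only [(channelPair_add_error α P ω q.1 a z).1]))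
  have hω' : gain ((channelPair α P ω).2 q.1) (p (channelPair α P ω).1 q.2) <
    δ₀ * errVar α P * sqNorm (p (channelPair α P ω).1 q.2) := hω
  show gain _ _ < _
  rw [Real.sq_sqrt hσ.le]
  exact hω'.trans_le (mul_le_mul_of_nonneg_right
    (mul_le_mul_of_nonneg_right (hle q) hσ.le) (sqNorm_nonneg _))

end Channel

/-! ### Limits -/

/-- Multiplexing gains can be read off from bounds up to `ε log₂ P + O(1)`. -/
lemma hasMultiplexingGain_of_bounds {R : ℝ → ℝ≥0∞} {d : ℝ} (hd : 0 ≤ d)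
    (hup : ∀ ε > 0, ∃ C : ℝ, ∀ᶠ P in atTop, R P ≤ ENNReal.ofReal ((d + ε) * Real.logb 2 P + C))
    (hlow : ∀ ε > 0, ∃ C : ℝ, ∀ᶠ P in atTop, ENNReal.ofReal ((d - ε) * Real.logb 2 P - C) ≤ R P) :
    HasMultiplexingGain R d := by
  have hlog : Tendsto (fun P => Real.logb 2 P) atTop atTop := Real.tendsto_logb_atTop one_lt_two
  refine (ENNReal.tendsto_nhds ENNReal.ofReal_ne_top).2 fun ε hε => ?_
  obtain ⟨η, hη0, hηε⟩ := ENNReal.lt_iff_exists_nnreal_btwn.1 hε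
  have hη : (0 : ℝ) < η := by exact_mod_cast hη0
  obtain ⟨C₁, h₁⟩ := hup (η / 2) (by positivity)
  obtain ⟨C₂, h₂⟩ := hlow (η / 2) (by positivity)
  filter_upwards [h₁, h₂, hlog.eventually_ge_atTop 1,
    hlog.eventually_ge_atTop (2 * C₁ / η), hlog.eventually_ge_atTop (2 * C₂ / η)]
    with P h₁ h₂ hL hC₁ hC₂
  set L := Real.logb 2 P
  have hL0 : 0 < L := by linarith
  have hL' : ENNReal.ofReal L ≠ 0 := by simpa using hL0
  rw [div_le_iff₀ hη] at hC₁ hC₂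
  constructor
  · refine (tsub_le_tsub_left hηε.le _).trans ?_
    rw [ENNReal.le_div_iff_mul_le (Or.inl hL') (Or.inl ENNReal.ofReal_ne_top),
      ← ENNReal.ofReal_coe_nnreal, ← ENNReal.ofReal_sub _ hη.le, ← ENNReal.ofReal_mul' hL0.le]
    refine (ENNReal.ofReal_le_ofReal ?_).trans h₂
    nlinarith
  · refine le_trans ?_ (add_le_add_right hηε.le _)
    rw [ENNReal.div_le_iff hL' ENNReal.ofReal_ne_top,
      ← ENNReal.ofReal_coe_nnreal, ← ENNReal.ofReal_add hd hη.le, ← ENNReal.ofReal_mul' hL0.le]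
    refine h₁.trans (ENNReal.ofReal_le_ofReal ?_)
    nlinarith

/-! ### Upper bounds on the max-min fair rate -/

section Converse

variable (J : Measure (Vectors M G g × Vectors M G g)) [IsFiniteMeasure J]

/-- The worst user of a group gets at most the average of the rates at which the strong user of
that group decodes all its streams. -/
lemma iInf_userRate_le_average (hg : 0 < g) (p : Vectors M G g → Vectors M G g)
    (Hhat : Vectors M G g) (i : Fin G) :
    ⨅ k, userRate J p Hhat k ≤ ∫⁻ H, ENNReal.ofReal
      ((∑ r, rate H (p Hhat) (i, ⟨0, hg⟩) (i, r)) / g) ∂J.condKernel Hhat := by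
  have hg0 : (g : ℝ≥0∞) ≠ 0 := by exact_mod_cast hg.ne'
  have hm : ∀ r, Measurable fun H => ENNReal.ofReal (rate H (p Hhat) (i, ⟨0, hg⟩) (i, r)) :=
    fun r => (measurable_id.rate measurable_const _ _).ennreal_ofReal
  have h1 : (g : ℝ≥0∞) * ⨅ k, userRate J p Hhat k ≤
      ∑ r, avgRate J p Hhat (i, ⟨0, hg⟩) (i, r) := by
    calc (g : ℝ≥0∞) * ⨅ k, userRate J p Hhat k = ∑ _r : Fin g, ⨅ k, userRate J p Hhat k := by simp
      _ ≤ _ := Finset.sum_le_sum fun r _ => (iInf_le _ (i, r)).trans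
        (iInf₂_le (⟨0, hg⟩ : Fin g) (Nat.zero_le _))
  have h2 : ∫⁻ H, ENNReal.ofReal
      ((∑ r, rate H (p Hhat) (i, ⟨0, hg⟩) (i, r)) / g) ∂J.condKernel Hhat =
      (∑ r, avgRate J p Hhat (i, ⟨0, hg⟩) (i, r)) / g := by
    simp_rw [ENNReal.ofReal_div_of_pos (show (0 : ℝ) < g by exact_mod_cast hg),
      ENNReal.ofReal_natCast, ENNReal.div_eq_inv_mul,
      ENNReal.ofReal_sum_of_nonneg fun r (_ : r ∈ Finset.univ) => rate_nonneg _ (p Hhat) _ (i, r)]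
    rw [lintegral_const_mul _ (Finset.measurable_sum _ fun r _ => hm r),
      lintegral_finsetSum _ fun r _ => hm r]
    rfl
  rw [h2, ENNReal.le_div_iff_mul_le (Or.inl hg0) (Or.inl (ENNReal.natCast_ne_top g)), mul_comm]
  exact h1

lemma iInf_userRate_le_own (p : Vectors M G g → Vectors M G g) (Hhat : Vectors M G g)
    (j : User G g) :
    ⨅ k, userRate J p Hhat k ≤
      ∫⁻ H, ENNReal.ofReal (rate H (p Hhat) j j) ∂J.condKernel Hhat :=
  (iInf_le _ j).trans (iInf₂_le (f := fun r _ => avgRate J p Hhat (j.1, r) j) j.2 le_rfl)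

/-- If, given each value of the estimates, the rate of the worst user is at most the conditional
mean of `A + energy H / log 2`, plus `L` on an exceptional event `B`, then the max-min fair rate is at
most the mean of this bound. -/
lemma mmfRate_le_of_forall (p : Vectors M G g → Vectors M G g) {A L E : ℝ} (hA : 0 ≤ A) (hE : 0 ≤ E)
    {B : Set (Vectors M G g × Vectors M G g)} (hB : MeasurableSet B) [IsProbabilityMeasure J]
    (hJ : ∫⁻ x, ENNReal.ofReal (energy x.2) ∂J ≤ ENNReal.ofReal E)
    {f : Vectors M G g → Vectors M G g → ℝ}
    (hf : ∀ Hhat, ⨅ k, userRate J p Hhat k ≤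
      ∫⁻ H, ENNReal.ofReal (f Hhat H) ∂J.condKernel Hhat)
    (hfA : ∀ Hhat H, (Hhat, H) ∉ B → f Hhat H ≤ A + energy H / Real.log 2)
    (hfL : ∀ Hhat H, f Hhat H ≤ L + (A + energy H / Real.log 2)) :
    mmfRate J p ≤ J B * ENNReal.ofReal L + ENNReal.ofReal (A + E / Real.log 2) := by
  have hl2 : 0 < Real.log 2 := Real.log_pos one_lt_two
  have hme : Measurable fun x : Vectors M G g × Vectors M G g => ENNReal.ofReal (energy x.2) :=
    (measurable_energy.comp measurable_snd).ennreal_ofReal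
  have hm1 : Measurable fun x : Vectors M G g × Vectors M G g =>
      B.indicator (fun _ => ENNReal.ofReal L) x := measurable_const.indicator hB
  have hm2 : Measurable fun x : Vectors M G g × Vectors M G g =>
      ENNReal.ofReal A + ENNReal.ofReal (energy x.2) / ENNReal.ofReal (Real.log 2) :=
    (hme.div_const _).const_add _
  calc mmfRate J p
      ≤ ∫⁻ Hhat, ∫⁻ H, (B.indicator (fun _ => ENNReal.ofReal L) (Hhat, H) +
          (ENNReal.ofReal A + ENNReal.ofReal (energy H) / ENNReal.ofReal (Real.log 2)))
          ∂J.condKernel Hhat ∂J.fst := by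
        refine lintegral_mono fun Hhat => (hf Hhat).trans (lintegral_mono fun H => ?_)
        rw [← ENNReal.ofReal_div_of_pos hl2,
          ← ENNReal.ofReal_add hA (div_nonneg (energy_nonneg H) hl2.le)]
        by_cases h : (Hhat, H) ∈ B
        · rw [Set.indicator_of_mem h]
          exact (ENNReal.ofReal_le_ofReal (hfL Hhat H)).trans ENNReal.ofReal_add_le
        · rw [Set.indicator_of_notMem h, zero_add]
          exact ENNReal.ofReal_le_ofReal (hfA Hhat H h)
    _ = ∫⁻ x, (B.indicator (fun _ => ENNReal.ofReal L) x +
          (ENNReal.ofReal A + ENNReal.ofReal (energy x.2) / ENNReal.ofReal (Real.log 2))) ∂J :=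
        Measure.lintegral_condKernel (hm1.add hm2)
    _ ≤ J B * ENNReal.ofReal L + ENNReal.ofReal (A + E / Real.log 2) := by
        rw [lintegral_add_left hm1, lintegral_indicator_const hB, mul_comm (J B),
          lintegral_add_left measurable_const, lintegral_const, measure_univ, mul_one,
          ENNReal.ofReal_add hA (div_nonneg hE hl2.le), ENNReal.ofReal_div_of_pos hl2]
        simp_rw [ENNReal.div_eq_inv_mul]
        rw [lintegral_const_mul _ hme]
        gcongr

end Converse

lemma logb_one_add_mul_le {x y : ℝ} (hx : 0 ≤ x) (hy : 0 ≤ y) :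
    Real.logb 2 (1 + x * y) ≤ Real.logb 2 (1 + y) + x / Real.log 2 := by
  have hl2 : 0 < Real.log 2 := Real.log_pos one_lt_two
  have h1 : Real.logb 2 (1 + x) ≤ x / Real.log 2 := by
    have := Real.log_le_sub_one_of_pos (show 0 < 1 + x by linarith)
    exact div_le_div_of_nonneg_right (by linarith) hl2.le
  calc Real.logb 2 (1 + x * y) ≤ Real.logb 2 ((1 + y) * (1 + x)) :=
        Real.logb_le_logb_of_le one_lt_two (by positivity) (by nlinarith)
    _ = Real.logb 2 (1 + y) + Real.logb 2 (1 + x) :=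
        Real.logb_mul (by positivity) (by positivity)
    _ ≤ _ := by linarith

lemma logb_one_add_mul_snr_le {x P : ℝ} (hx : 0 ≤ x) (hP : 1 < P) :
    Real.logb 2 (1 + x * P) ≤ Real.logb 2 P + (1 + x / Real.log 2) := by
  have h1 : Real.logb 2 (1 + P) ≤ Real.logb 2 (2 * P) :=
    Real.logb_le_logb_of_le one_lt_two (by linarith) (by linarith)
  rw [Real.logb_mul (by norm_num) (by linarith), Real.logb_self_eq_one one_lt_two] at h1
  have := logb_one_add_mul_le hx (show 0 ≤ P by linarith)
  linarith

lemma sum_gain_le (H p : Vectors M G g) (j : User G g) :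
    ∑ r, gain (H j) (p (j.1, r)) ≤ energy H * ∑ r, sqNorm (p (j.1, r)) := by
  rw [Finset.mul_sum]
  exact Finset.sum_le_sum fun r _ => (gain_le _ _).trans
    (mul_le_mul_of_nonneg_right (sqNorm_le_energy H j) (sqNorm_nonneg _))

lemma sum_group_le (p : Vectors M G g) (i : Fin G) :
    ∑ r, sqNorm (p (i, r)) ≤ ∑ k, sqNorm (p k) := by
  rw [Fintype.sum_prod_type]
  exact Finset.single_le_sum (f := fun i => ∑ r, sqNorm (p (i, r)))
    (fun i _ => Finset.sum_nonneg fun r _ => sqNorm_nonneg _) (Finset.mem_univ i)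

/-- The crude bound `log₂ P + O(1)` on the sum of the rates of all the streams of a group. -/
lemma sum_rate_le_snr (H p : Vectors M G g) (j : User G g) {P : ℝ} (hP : 1 < P)
    (hp : ∑ k, sqNorm (p k) ≤ P) :
    ∑ r, rate H p j (j.1, r) ≤ Real.logb 2 P + (1 + energy H / Real.log 2) := by
  rw [sum_rate_eq]
  refine le_trans ?_ (logb_one_add_mul_snr_le (energy_nonneg H) hP)
  have h0 : 0 ≤ ∑ r, gain (H j) (p (j.1, r)) := Finset.sum_nonneg fun r _ => gain_nonneg _ _
  have hI := interInterference_nonneg H p j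
  have h1 := (sum_gain_le H p j).trans
    (mul_le_mul_of_nonneg_left ((sum_group_le p j.1).trans hp) (energy_nonneg H))
  have h2 := div_le_self h0 (show 1 ≤ interInterference H p j + 1 by linarith)
  have h3 : 0 ≤ (∑ r, gain (H j) (p (j.1, r))) / (interInterference H p j + 1) := by positivity
  exact Real.logb_le_logb_of_le one_lt_two (by linarith) (by linarith)

/-- If the interference from the other groups is comparable to the strongest of all the streams,
then the streams of a group have a bounded sum rate. -/
lemma sum_rate_le_of_interference (H p : Vectors M G g) (j : User G g) {q κ : ℝ} (hκ : 0 < κ)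
    (hq : ∀ k, sqNorm (p k) ≤ q) (hI : κ * q ≤ interInterference H p j) :
    ∑ r, rate H p j (j.1, r) ≤ Real.logb 2 (1 + g / κ) + energy H / Real.log 2 := by
  rw [sum_rate_eq]
  refine le_trans ?_ (logb_one_add_mul_le (energy_nonneg H) (show 0 ≤ g / κ by positivity))
  have h0 : 0 ≤ ∑ r, gain (H j) (p (j.1, r)) := Finset.sum_nonneg fun r _ => gain_nonneg _ _
  have hI0 := interInterference_nonneg H p j
  have hE := energy_nonneg H
  have hle : (∑ r, gain (H j) (p (j.1, r))) / (interInterference H p j + 1) ≤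
      energy H * (g / κ) := by
    rw [div_le_iff₀ (by linarith)]
    calc ∑ r, gain (H j) (p (j.1, r)) ≤ energy H * ∑ r, sqNorm (p (j.1, r)) := sum_gain_le H p j
      _ ≤ energy H * (g * q) := by
          refine mul_le_mul_of_nonneg_left ?_ hE
          refine (Finset.sum_le_card_nsmul _ _ q fun r _ => hq _).trans_eq ?_
          simp
      _ = energy H * (g / κ) * (κ * q) := by field_simp
      _ ≤ energy H * (g / κ) * (interInterference H p j + 1) := by gcongr; linarith
  have h3 : 0 ≤ (∑ r, gain (H j) (p (j.1, r))) / (interInterference H p j + 1) := by positivity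
  exact Real.logb_le_logb_of_le one_lt_two (by linarith) (by linarith)

lemma gain_le_interInterference (H p : Vectors M G g) {j m : User G g} (hm : m.1 ≠ j.1) :
    gain (H j) (p m) ≤ interInterference H p j :=
  Finset.single_le_sum (f := fun m => gain (H j) (p m)) (fun _ _ => gain_nonneg _ _)
    (Finset.mem_filter.2 ⟨Finset.mem_univ m, hm⟩)

lemma mul_ofReal_add_le {x : ℝ≥0∞} {ε L A : ℝ} (hε : 0 ≤ ε) (hL : 0 ≤ L) (hA : 0 ≤ A)
    (hx : x ≤ ENNReal.ofReal ε) :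
    x * ENNReal.ofReal L + ENNReal.ofReal A ≤ ENNReal.ofReal (ε * L + A) := by
  rw [ENNReal.ofReal_add (mul_nonneg hε hL) hA, ENNReal.ofReal_mul hε]
  gcongr

section Bounds

variable {α : ℝ} {Γ : User G g → ℝ} {ν : ℝ → Measure (Vectors M G g × Vectors M G g)}
  [∀ P, IsProbabilityMeasure (ν P)]

/-- With a single group, the strong user decodes everything, so that the sum rate is at most
`log₂ P + O(1)`. -/
lemma exists_mmfRate_le_single_user (hG : 0 < G) (hg : 0 < g) (hν : IsFadingModel Γ ν)
    (hα : 0 ≤ α) :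
    ∃ C : ℝ, ∀ P > 1, ∀ p, IsScheme P p →
      mmfRate (jointLaw α ν P) p ≤ ENNReal.ofReal (1 / g * Real.logb 2 P + C) := by
  have hl2 : 0 < Real.log 2 := Real.log_pos one_lt_two
  have hg1 : (1 : ℝ) ≤ g := by exact_mod_cast hg
  have hΓ : 0 ≤ ∑ k, Γ k := Finset.sum_nonneg fun k _ => (hν.power_pos k).le
  refine ⟨1 + (4 * ∑ k, Γ k) / Real.log 2, fun P hP p hp => ?_⟩
  have hL : 0 < Real.logb 2 P := Real.logb_pos one_lt_two hP
  have hf : ∀ Hhat H : Vectors M G g,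
      (∑ r, rate H (p Hhat) (⟨0, hG⟩, ⟨0, hg⟩) (⟨0, hG⟩, r)) / g ≤
        1 / g * Real.logb 2 P + 1 + energy H / Real.log 2 := by
    intro Hhat H
    have h1 := sum_rate_le_snr H (p Hhat) (⟨0, hG⟩, ⟨0, hg⟩) hP (hp.power_le Hhat)
    have h2 : 0 ≤ energy H / Real.log 2 := div_nonneg (energy_nonneg H) hl2.le
    refine (div_le_div_of_nonneg_right h1 (by linarith)).trans ?_
    rw [add_div, one_div, inv_mul_eq_div, add_assoc]
    gcongr
    exact div_le_self (by linarith) hg1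
  have h := mmfRate_le_of_forall (jointLaw α ν P) p (A := 1 / g * Real.logb 2 P + 1) (L := 0)
    (by positivity) (by positivity) MeasurableSet.empty (lintegral_energy_channel_le hν hα hP)
    (fun Hhat => iInf_userRate_le_average _ hg p Hhat ⟨0, hG⟩) (fun Hhat H _ => hf Hhat H)
    (fun Hhat H => by simpa using hf Hhat H)
  refine h.trans_eq ?_
  simp [add_assoc]

/-- With several groups, the channel error makes the strongest stream leak to another group at a
power `σ_e²` below its own, which bounds the sum rate of that group by `α log₂ P + O(1)`. -/
lemma exists_mmfRate_le_quality (hM : 1 ≤ M) (hG : 1 < G) (hg : 0 < g) (hν : IsFadingModel Γ ν)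
    (hα : 0 ≤ α) {ε : ℝ} (hε : 0 < ε) :
    ∃ C : ℝ, ∀ P > 1, ∀ p, IsScheme P p →
      mmfRate (jointLaw α ν P) p ≤ ENNReal.ofReal ((α / g + ε) * Real.logb 2 P + C) := by
  have hl2 : 0 < Real.log 2 := Real.log_pos one_lt_two
  have hg1 : (1 : ℝ) ≤ g := by exact_mod_cast hg
  have hΓ : 0 ≤ ∑ k, Γ k := Finset.sum_nonneg fun k _ => (hν.power_pos k).le
  obtain ⟨δ, hδ, hB⟩ := exists_measure_gain_precoder_lt hM hν α (ENNReal.ofReal_pos.2 hε)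
  have hD : 0 ≤ Real.logb 2 (1 + g / δ) := Real.logb_nonneg one_lt_two (by simp; positivity)
  refine ⟨1 + Real.logb 2 (1 + g / δ) + (4 * ∑ k, Γ k) / Real.log 2, fun P hP p hp => ?_⟩
  have hL : 0 < Real.logb 2 P := Real.logb_pos one_lt_two hP
  have hσ := errVar_pos α hP
  have hκ : Real.logb 2 (1 + g / (δ * errVar α P)) ≤
      α * Real.logb 2 P + Real.logb 2 (1 + g / δ) := by
    have h1 : 1 + g / (δ * errVar α P) ≤ P ^ α * (1 + g / δ) := by
      have h2 : 1 ≤ P ^ α := Real.one_le_rpow hP.le hα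
      have h3 : g / (δ * errVar α P) = P ^ α * (g / δ) := by
        rw [errVar, Real.rpow_neg (by linarith)]
        field_simp
      rw [h3]
      linarith
    refine (Real.logb_le_logb_of_le one_lt_two (by positivity) h1).trans_eq ?_
    rw [Real.logb_mul (by positivity) (by positivity),
      Real.logb_rpow_eq_mul_logb_of_pos (by linarith)]
  set B : Set (Vectors M G g × Vectors M G g) := ⋃ q : User G g × User G g,
    {x | gain (x.2 q.1) (p x.1 q.2) < δ * errVar α P * sqNorm (p x.1 q.2)} with hBdef
  have hBm : MeasurableSet B := by
    refine MeasurableSet.iUnion fun q => ?_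
    have hm1 : Measurable fun x : Vectors M G g × Vectors M G g => x.2 q.1 := by fun_prop
    have hm2 : Measurable fun x : Vectors M G g × Vectors M G g => p x.1 q.2 :=
      (measurable_pi_apply q.2).comp (hp.measurable.comp measurable_fst)
    exact measurableSet_lt (hm1.gain hm2) (hm2.sqNorm.const_mul _)
  -- Given the estimates, consider the strong user of a group without the strongest stream `m`.
  have hne : Nonempty (User G g) := ⟨(⟨0, by omega⟩, ⟨0, hg⟩)⟩
  have hfin : Nontrivial (Fin G) := Fin.nontrivial_iff_two_le.2 hG
  choose m hm using fun Hhat => Finite.exists_max fun k => sqNorm (p Hhat k)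
  choose i hi using fun Hhat => exists_ne (m Hhat).1
  have h := mmfRate_le_of_forall (jointLaw α ν P) p
    (A := α / g * Real.logb 2 P + (1 + Real.logb 2 (1 + g / δ))) (L := Real.logb 2 P)
    (f := fun Hhat H => (∑ r, rate H (p Hhat) (i Hhat, ⟨0, hg⟩) (i Hhat, r)) / g)
    (by positivity) (by positivity) hBm (lintegral_energy_channel_le hν hα hP)
    (fun Hhat => iInf_userRate_le_average _ hg p Hhat (i Hhat)) ?_ ?_
  · refine h.trans ((mul_ofReal_add_le hε.le hL.le (by positivity) (hB P hP p hp.measurable)).trans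
      (ENNReal.ofReal_le_ofReal (le_of_eq ?_)))
    ring
  · intro Hhat H hH
    have hI : δ * errVar α P * sqNorm (p Hhat (m Hhat)) ≤
        interInterference H (p Hhat) (i Hhat, ⟨0, hg⟩) := by
      refine le_trans (not_lt.1 fun hlt => hH ?_)
        (gain_le_interInterference H (p Hhat) (j := (i Hhat, ⟨0, hg⟩)) (hi Hhat).symm)
      exact Set.mem_iUnion.2 ⟨((i Hhat, ⟨0, hg⟩), m Hhat), hlt⟩
    have h1 := (sum_rate_le_of_interference H (p Hhat) (i Hhat, ⟨0, hg⟩) (by positivity)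
      (hm Hhat) hI).trans (add_le_add_left hκ _)
    have h2 : 0 ≤ energy H / Real.log 2 := div_nonneg (energy_nonneg H) hl2.le
    refine (div_le_div_of_nonneg_right h1 (by linarith)).trans ?_
    rw [add_assoc, add_div, div_mul_eq_mul_div, add_assoc]
    gcongr
    exact (div_le_self (by linarith) hg1).trans (by linarith)
  · intro Hhat H
    have h1 := sum_rate_le_snr H (p Hhat) (i Hhat, ⟨0, hg⟩) hP (hp.power_le Hhat)
    have h2 : 0 ≤ energy H / Real.log 2 := div_nonneg (energy_nonneg H) hl2.le
    have h3 : 0 ≤ α / g * Real.logb 2 P := by positivity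
    refine (div_le_div_of_nonneg_right h1 (by linarith)).trans
      ((div_le_self (by linarith) hg1).trans (by linarith))

end Bounds

/-! ### Too few antennas to zero-force -/

/-- The matrix whose rows are the conjugates of the vectors of `M` selected users. -/
noncomputable def rowsMatrix (e : Fin M → User G g) (a : Vectors M G g) :
    Matrix (Fin M) (Fin M) ℂ :=
  Matrix.of fun l m => star (a (e l) m)

lemma measurable_rowsMatrix (e : Fin M → User G g) (l m : Fin M) :
    Measurable fun a : Vectors M G g => rowsMatrix e a l m := by
  have : Measurable fun a : Vectors M G g => a (e l) m := by fun_prop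
  exact continuous_star.measurable.comp this

lemma measurable_det_rowsMatrix (e : Fin M → User G g) :
    Measurable fun a : Vectors M G g => (rowsMatrix e a).det := by
  simp_rw [Matrix.det_apply']
  have := measurable_rowsMatrix e
  fun_prop

lemma measurable_inv_rowsMatrix (e : Fin M → User G g) (l m : Fin M) :
    Measurable fun a : Vectors M G g => (rowsMatrix e a)⁻¹ l m := by
  simp_rw [Matrix.inv_def, Matrix.smul_apply, Ring.inverse_eq_inv', smul_eq_mul,
    Matrix.adjugate_apply]
  refine (measurable_det_rowsMatrix e).inv.mul ?_
  simp_rw [Matrix.det_apply']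
  refine Finset.measurable_sum _ fun σ _ => Measurable.const_mul ?_ _
  refine Finset.measurable_prod _ fun k _ => ?_
  by_cases h : σ k = m
  · simp only [h, Matrix.updateRow_self]
    exact measurable_const
  · simp only [Matrix.updateRow_ne h]
    exact measurable_rowsMatrix e _ _

/-- Generic vectors are linearly independent: on every line in the direction of the identity matrix,
the determinant is a nonzero polynomial. -/
lemma volume_det_rowsMatrix_eq_zero {e : Fin M → User G g} (he : Function.Injective e) :
    volume {ω : Vectors M G g × Vectors M G g | (rowsMatrix e ω.1).det = 0} = 0 := by
  classical
  have hms : MeasurableSet {ω : Vectors M G g × Vectors M G g | (rowsMatrix e ω.1).det ≠ 0} :=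
    (measurable_det_rowsMatrix e).comp measurable_fst (measurableSet_singleton 0).compl
  let d : Vectors M G g × Vectors M G g := (fun k m => if k = e m then 1 else 0, 0)
  have h := ae_mem_of_ae_add_linearMap_mem (LinearMap.toSpanSingleton ℝ _ d)
    (volume : Measure ℝ) (volume : Measure (Vectors M G g × Vectors M G g)) hms ?_
  · rw [ae_iff] at h
    simpa using h
  · intro y
    have hline : ∀ t : ℝ, rowsMatrix e (y + t • d).1 =
        Matrix.scalar (Fin M) (t : ℂ) - (-rowsMatrix e y.1) := by
      intro t
      ext l m
      by_cases hlm : l = m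
      · subst hlm
        simp [rowsMatrix, d]
        ring
      · simp [rowsMatrix, d, he.eq_iff, hlm]
    have hfin : {t : ℝ | (rowsMatrix e (y + t • d).1).det = 0}.Finite := by
      refine ((Polynomial.finite_setOfPred_isRoot
        (Matrix.charpoly_monic (-rowsMatrix e y.1)).ne_zero).preimage
        Complex.ofReal_injective.injOn).subset fun t ht => ?_
      have ht' : (rowsMatrix e (y + t • d).1).det = 0 := ht
      show (Matrix.charpoly (-rowsMatrix e y.1)).eval (t : ℂ) = 0
      rw [Matrix.eval_charpoly, ← hline, ht']
    rw [ae_iff]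
    simpa using hfin.measure_zero volume

/-- The squared Frobenius norm of the inverse of `rowsMatrix`. -/
noncomputable def invPower (e : Fin M → User G g) (a : Vectors M G g) : ℝ :=
  ∑ l, ∑ m, ‖(rowsMatrix e a)⁻¹ l m‖ ^ 2

lemma measurable_invPower (e : Fin M → User G g) :
    Measurable (invPower e : Vectors M G g → ℝ) :=
  Finset.measurable_sum _ fun l _ => Finset.measurable_sum _ fun m _ =>
    (measurable_inv_rowsMatrix e l m).norm.pow_const 2

lemma sqNorm_le_invPower_mul (e : Fin M → User G g) {a : Vectors M G g}
    (ha : (rowsMatrix e a).det ≠ 0) (p : Fin M → ℂ) :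
    sqNorm p ≤ invPower e a * ∑ l, gain (a (e l)) p := by
  have hp : p = (rowsMatrix e a)⁻¹ *ᵥ (rowsMatrix e a *ᵥ p) := by
    rw [Matrix.mulVec_mulVec, Matrix.nonsing_inv_mul _ ha.isUnit, Matrix.one_mulVec]
  have hg : ∀ l, gain (a (e l)) p = ‖(rowsMatrix e a *ᵥ p) l‖ ^ 2 := fun l => rfl
  simp_rw [hg]
  rw [invPower, Finset.sum_mul]
  conv_lhs => rw [hp]
  refine Finset.sum_le_sum fun l _ => ?_
  have h1 : ‖((rowsMatrix e a)⁻¹ *ᵥ (rowsMatrix e a *ᵥ p)) l‖ ≤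
      ∑ m, ‖(rowsMatrix e a)⁻¹ l m‖ * ‖(rowsMatrix e a *ᵥ p) m‖ := by
    conv_lhs => rw [Matrix.mulVec, dotProduct]
    exact (norm_sum_le _ _).trans_eq (Finset.sum_congr rfl fun m _ => norm_mul _ _)
  exact (pow_le_pow_left₀ (norm_nonneg _) h1 2).trans (Finset.sum_mul_sq_le_sq_mul_sq _ _ _)

lemma card_other_groups (i : Fin G) : Fintype.card {k : User G g // k.1 ≠ i} = g * G - g := by
  have h1 : Fintype.card {k : User G g // k.1 = i} = g := by
    rw [Fintype.card_congr (β := Fin g) ⟨fun k => k.1.2, fun r => ⟨(i, r), rfl⟩,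
      fun k => Subtype.ext (Prod.ext k.2.symm rfl), fun r => rfl⟩, Fintype.card_fin]
  rw [Fintype.card_subtype_compl, h1, Fintype.card_prod, Fintype.card_fin, Fintype.card_fin,
    mul_comm]

lemma exists_embedding_of_antennas {K : ℕ} (hK : K = g * G) (hMK : M < K - g + 1) (i : Fin G) :
    ∃ e : Fin M → User G g, Function.Injective e ∧ ∀ l, (e l).1 ≠ i := by
  obtain ⟨f⟩ := Function.Embedding.nonempty_of_card_le
    (show Fintype.card (Fin M) ≤ Fintype.card {k : User G g // k.1 ≠ i} by
      rw [card_other_groups, Fintype.card_fin]; omega)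
  exact ⟨fun l => (f l).1, fun l m h => f.injective (Subtype.ext h), fun l => (f l).2⟩

section FewAntennas

variable {α : ℝ} {Γ : User G g → ℝ} {ν : ℝ → Measure (Vectors M G g × Vectors M G g)}

/-- With high probability, the estimates of the users outside of any group span the whole space
quantitatively, so that no precoder is nearly orthogonal to all of them. -/
lemma exists_spanning_event (hν : IsFadingModel Γ ν) (hM : 1 ≤ M) {K : ℕ} (hK : K = g * G)
    (hMK : M < K - g + 1) {ε : ℝ≥0∞} (hε : 0 < ε) :
    ∃ κ : ℝ, 0 < κ ∧ ∃ T : Set (Vectors M G g), MeasurableSet T ∧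
      (∀ a ∈ T, ∀ i p, ∃ j : User G g, j.1 ≠ i ∧ κ * sqNorm p ≤ gain (a j) p) ∧
      ∀ P > 1, ν P {ω | ω.1 ∉ T} ≤ ε := by
  have hM0 : (0 : ℝ) < M := by exact_mod_cast hM
  choose e he hei using fun i => exists_embedding_of_antennas (M := M) hK hMK i
  set N : Vectors M G g × Vectors M G g → ℝ := fun ω => ∑ i, invPower (e i) ω.1
  have hN : Measurable N :=
    Finset.measurable_sum _ fun i _ => (measurable_invPower (e i)).comp measurable_fst
  have hN0 : ∀ i a, 0 ≤ invPower (e i) a := fun i a =>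
    Finset.sum_nonneg fun _ _ => Finset.sum_nonneg fun _ _ => sq_nonneg _
  obtain ⟨R, hR, hRP⟩ := exists_bound_of_measurable hν hN hε
  refine ⟨1 / (R * M), by positivity,
    {a | (∀ i, (rowsMatrix (e i) a).det ≠ 0) ∧ ∑ i, invPower (e i) a ≤ R}, ?_, ?_, ?_⟩
  · have h1 : MeasurableSet {a : Vectors M G g | ∀ i, (rowsMatrix (e i) a).det ≠ 0} := by
      have : {a : Vectors M G g | ∀ i, (rowsMatrix (e i) a).det ≠ 0} =
          ⋂ i, {a | (rowsMatrix (e i) a).det ≠ 0} := by ext; simp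
      rw [this]
      exact MeasurableSet.iInter fun i =>
        measurable_det_rowsMatrix (e i) (measurableSet_singleton 0).compl
    exact h1.inter (measurableSet_le
      (Finset.measurable_sum _ fun i _ => measurable_invPower (e i)) measurable_const)
  · rintro a ⟨hdet, haR⟩ i p
    have : Nonempty (Fin M) := ⟨⟨0, hM⟩⟩
    obtain ⟨l, hl⟩ := Finite.exists_max fun l => gain (a (e i l)) p
    refine ⟨e i l, hei i l, ?_⟩
    have h1 : invPower (e i) a ≤ R :=
      (Finset.single_le_sum (f := fun i => invPower (e i) a) (fun i _ => hN0 i a)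
        (Finset.mem_univ i)).trans haR
    have h2 : ∑ l, gain (a (e i l)) p ≤ M * gain (a (e i l)) p := by
      refine (Finset.sum_le_card_nsmul _ _ _ fun l _ => hl l).trans_eq ?_
      simp
    have h3 : sqNorm p ≤ R * (M * gain (a (e i l)) p) :=
      (sqNorm_le_invPower_mul (e i) (hdet i) p).trans
        (mul_le_mul h1 h2 (Finset.sum_nonneg fun _ _ => gain_nonneg _ _) hR.le)
    rw [one_div, inv_mul_le_iff₀ (by positivity)]
    linarith
  · intro P hP
    have hnull : ν P {ω | ∃ i, (rowsMatrix (e i) ω.1).det = 0} = 0 := by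
      have : {ω : Vectors M G g × Vectors M G g | ∃ i, (rowsMatrix (e i) ω.1).det = 0} =
          ⋃ i, {ω | (rowsMatrix (e i) ω.1).det = 0} := by ext; simp
      rw [this, measure_iUnion_null_iff]
      exact fun i => measure_eq_zero_of_volume hν
        ((measurable_det_rowsMatrix (e i)).comp measurable_fst (measurableSet_singleton 0))
        (volume_det_rowsMatrix_eq_zero (he i)) hP
    calc ν P _ ≤ ν P ({ω | ∃ i, (rowsMatrix (e i) ω.1).det = 0} ∪ {ω | R < N ω}) := by
          refine measure_mono fun ω hω => ?_
          by_contra hcon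
          refine hω ⟨fun i hi => hcon (Or.inl ⟨i, hi⟩), not_lt.1 fun hlt => hcon (Or.inr hlt)⟩
      _ ≤ 0 + ε := (measure_union_le _ _).trans (add_le_add hnull.le (hRP P hP))
      _ = ε := zero_add ε

lemma sqNorm_sub_comm (v w : Fin M → ℂ) : sqNorm (v - w) = sqNorm (w - v) := by
  simp [sqNorm, norm_sub_rev]

lemma tendsto_errVar (hα : 0 < α) : Tendsto (errVar α) atTop (𝓝 0) := tendsto_rpow_neg_atTop hα

/-- With too few antennas for zero-forcing and several groups, the strongest stream leaks at its
full power to a user of another group, whose rate is therefore bounded. -/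
lemma exists_mmfRate_le_of_few_antennas [∀ P, IsProbabilityMeasure (ν P)] (hM : 1 ≤ M)
    (hG : 0 < G) (hg : 0 < g) (hν : IsFadingModel Γ ν) (hα : 0 < α) {K : ℕ} (hK : K = g * G)
    (hMK : M < K - g + 1) {ε : ℝ} (hε : 0 < ε) :
    ∃ C : ℝ, ∀ᶠ P in atTop, ∀ p, IsScheme P p →
      mmfRate (jointLaw α ν P) p ≤ ENNReal.ofReal (ε * Real.logb 2 P + C) := by
  have hl2 : 0 < Real.log 2 := Real.log_pos one_lt_two
  have hΓ : 0 ≤ ∑ k, Γ k := Finset.sum_nonneg fun k _ => (hν.power_pos k).le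
  have hε' : 0 < ENNReal.ofReal (ε / 2) := ENNReal.ofReal_pos.2 (by positivity)
  obtain ⟨κ, hκ, T, hT, hTspan, hTP⟩ := exists_spanning_event hν hM hK hMK hε'
  obtain ⟨R, hR, hRP⟩ := exists_energy_bound hν hε'
  have hD : 0 ≤ Real.logb 2 (1 + g / (κ / 8)) := Real.logb_nonneg one_lt_two (by simp; positivity)
  refine ⟨1 + Real.logb 2 (1 + g / (κ / 8)) + (4 * ∑ k, Γ k) / Real.log 2, ?_⟩
  filter_upwards [eventually_gt_atTop 1,
    (tendsto_errVar hα).eventually (gt_mem_nhds (show (0 : ℝ) < 1 / 2 by norm_num)),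
    (tendsto_errVar hα).eventually (gt_mem_nhds (show 0 < κ / (8 * R) by positivity))]
    with P hP hσ1 hσ2 p hp
  have hL : 0 < Real.logb 2 P := Real.logb_pos one_lt_two hP
  have hσ := errVar_pos α hP
  set s := √(1 - errVar α P) with hs
  have hs0 : 0 < s := Real.sqrt_pos.2 (by linarith)
  have hs2 : 1 / 2 ≤ s ^ 2 := by rw [hs, Real.sq_sqrt (by linarith)]; linarith
  have hsC : (s : ℂ) ≠ 0 := by exact_mod_cast hs0.ne'
  set B : Set (Vectors M G g × Vectors M G g) :=
    {x | (s : ℂ)⁻¹ • x.1 ∉ T} ∪ ⋃ j, {x | κ / 8 < sqNorm (x.2 j - x.1 j)} with hBdef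
  have hBm1 : MeasurableSet {x : Vectors M G g × Vectors M G g | (s : ℂ)⁻¹ • x.1 ∉ T} :=
    hT.compl.preimage (by fun_prop :
      Measurable fun x : Vectors M G g × Vectors M G g => (s : ℂ)⁻¹ • x.1)
  have hBm2 : MeasurableSet
      (⋃ j, {x : Vectors M G g × Vectors M G g | κ / 8 < sqNorm (x.2 j - x.1 j)}) := by
    refine MeasurableSet.iUnion fun j => measurableSet_lt measurable_const ?_
    have : Measurable fun x : Vectors M G g × Vectors M G g => x.2 j - x.1 j := by fun_prop
    exact this.sqNorm
  have hBP : jointLaw α ν P B ≤ ENNReal.ofReal ε := by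
    calc jointLaw α ν P B ≤ ENNReal.ofReal (ε / 2) + ENNReal.ofReal (ε / 2) := by
          refine (measure_union_le _ _).trans (add_le_add ?_ ?_)
          · rw [jointLaw_apply α P hBm1]
            refine (measure_mono fun ω hω => ?_).trans (hTP P hP)
            have h : (s : ℂ)⁻¹ • (channelPair α P ω).1 ∉ T := hω
            rwa [channelPair_fst, smul_smul, inv_mul_cancel₀ hsC, one_smul] at h
          · rw [jointLaw_apply α P hBm2]
            refine (measure_mono fun ω hω => ?_).trans (hRP P hP)
            obtain ⟨j, hj⟩ := Set.mem_iUnion.1 hω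
            have hj' : κ / 8 <
                sqNorm ((channelPair α P ω).2 j - (channelPair α P ω).1 j) := hj
            rw [sqNorm_channelPair_sub hP] at hj'
            have h1 := sqNorm_le_energy ω.2 j
            have h2 := energy_nonneg ω.1
            rw [lt_div_iff₀ (by positivity)] at hσ2
            show R < _
            by_contra! hle
            have := mul_le_mul_of_nonneg_left (show sqNorm (ω.2 j) ≤ R by linarith) hσ.le
            linarith
      _ = ENNReal.ofReal ε := by
          rw [← ENNReal.ofReal_add (by positivity) (by positivity), add_halves]
  have hne : Nonempty (User G g) := ⟨(⟨0, hG⟩, ⟨0, hg⟩)⟩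
  choose m hm using fun Hhat => Finite.exists_max fun k => sqNorm (p Hhat k)
  -- Given the estimates, consider the user of another group at which the strongest stream `m` is
  -- received best; outside of the spanning event, any user will do.
  have hj : ∀ Hhat : Vectors M G g, ∃ j : User G g, (s : ℂ)⁻¹ • Hhat ∈ T →
      j.1 ≠ (m Hhat).1 ∧ κ * sqNorm (p Hhat (m Hhat)) ≤
        gain (((s : ℂ)⁻¹ • Hhat) j) (p Hhat (m Hhat)) := by
    intro Hhat
    by_cases h : (s : ℂ)⁻¹ • Hhat ∈ T
    · obtain ⟨j, hj⟩ := hTspan _ h (m Hhat).1 (p Hhat (m Hhat))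
      exact ⟨j, fun _ => hj⟩
    · exact ⟨hne.some, fun h' => absurd h' h⟩
  choose j hj using hj
  have hown : ∀ Hhat H, rate H (p Hhat) (j Hhat) (j Hhat) ≤
      ∑ r, rate H (p Hhat) (j Hhat) ((j Hhat).1, r) := fun Hhat H =>
    Finset.single_le_sum (f := fun r => rate H (p Hhat) (j Hhat) ((j Hhat).1, r))
      (fun r _ => rate_nonneg _ _ _ _) (Finset.mem_univ (j Hhat).2)
  have h := mmfRate_le_of_forall (jointLaw α ν P) p
    (A := 1 + Real.logb 2 (1 + g / (κ / 8))) (L := Real.logb 2 P)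
    (f := fun Hhat H => rate H (p Hhat) (j Hhat) (j Hhat))
    (by positivity) (by positivity) (hBm1.union hBm2) (lintegral_energy_channel_le hν hα.le hP)
    (fun Hhat => iInf_userRate_le_own _ p Hhat (j Hhat)) ?_ ?_
  · exact h.trans (mul_ofReal_add_le hε.le hL.le (by positivity) hBP)
  · intro Hhat H hH
    have hH1 : (s : ℂ)⁻¹ • Hhat ∈ T := by
      by_contra hcon
      exact hH (Or.inl hcon)
    have hH2 : sqNorm (Hhat (j Hhat) - H (j Hhat)) ≤ κ / 8 := by
      rw [sqNorm_sub_comm]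
      exact not_lt.1 fun hlt => hH (Or.inr (Set.mem_iUnion.2 ⟨j Hhat, hlt⟩))
    obtain ⟨hj1, hj2⟩ := hj Hhat hH1
    set q := sqNorm (p Hhat (m Hhat))
    have hq : 0 ≤ q := sqNorm_nonneg _
    have hsg : gain (Hhat (j Hhat)) (p Hhat (m Hhat)) =
        s ^ 2 * gain (((s : ℂ)⁻¹ • Hhat) (j Hhat)) (p Hhat (m Hhat)) := by
      have : Hhat (j Hhat) = (s : ℂ) • ((s : ℂ)⁻¹ • Hhat) (j Hhat) := by
        rw [Pi.smul_apply, smul_smul, mul_inv_cancel₀ hsC, one_smul]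
      conv_lhs => rw [this]
      rw [gain_smul_left, Complex.norm_real, Real.norm_eq_abs, sq_abs]
    have h1 : κ / 2 * q ≤ gain (Hhat (j Hhat)) (p Hhat (m Hhat)) := by
      rw [hsg]
      have := mul_le_mul hs2 hj2 (by positivity) (by positivity)
      linarith
    have h2 := gain_add_le (H (j Hhat)) (Hhat (j Hhat) - H (j Hhat)) (p Hhat (m Hhat))
    rw [add_sub_cancel] at h2
    have h3 := (gain_le (Hhat (j Hhat) - H (j Hhat)) (p Hhat (m Hhat))).trans
      (mul_le_mul_of_nonneg_right hH2 hq)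
    have hI : κ / 8 * q ≤ interInterference H (p Hhat) (j Hhat) :=
      le_trans (by linarith) (gain_le_interInterference H (p Hhat) hj1.symm)
    have h4 := (hown Hhat H).trans
      (sum_rate_le_of_interference H (p Hhat) (j Hhat) (by positivity) (hm Hhat) hI)
    show rate _ _ _ _ ≤ _
    linarith
  · intro Hhat H
    have h1 := (hown Hhat H).trans
      (sum_rate_le_snr H (p Hhat) (j Hhat) hP (hp.power_le Hhat))
    show rate _ _ _ _ ≤ _
    linarith

end FewAntennas

/-! ### Zero-forcing directions -/

/-- The component of `x` orthogonal to the vectors `H k`, `k ∈ L`, computed by Gram–Schmidt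
orthogonalization. A vanishing pivot contributes nothing, as `0 / 0 = 0`. -/
noncomputable def residual (H : Vectors M G g) : List (User G g) → (Fin M → ℂ) → Fin M → ℂ
  | [], x => x
  | k :: L, x => residual H L x -
      ((star (residual H L (H k)) ⬝ᵥ residual H L x) /
        (star (residual H L (H k)) ⬝ᵥ residual H L (H k))) • residual H L (H k)

lemma sub_residual_mem_span (H : Vectors M G g) (L : List (User G g)) (x : Fin M → ℂ) :
    x - residual H L x ∈ Submodule.span ℂ (H '' {k | k ∈ L}) := by
  induction L generalizing x with
  | nil => simp [residual]
  | cons k L ih =>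
    have hle : Submodule.span ℂ (H '' {j | j ∈ L}) ≤ Submodule.span ℂ (H '' {j | j ∈ k :: L}) :=
      Submodule.span_mono (Set.image_mono fun j hj => List.mem_cons_of_mem k hj)
    have hk : residual H L (H k) ∈ Submodule.span ℂ (H '' {j | j ∈ k :: L}) := by
      have h1 := Submodule.subset_span (R := ℂ)
        (Set.mem_image_of_mem H (show k ∈ {j | j ∈ k :: L} from List.mem_cons_self))
      simpa using Submodule.sub_mem _ h1 (hle (ih (H k)))
    rw [residual, sub_sub_eq_add_sub, add_sub_right_comm]
    exact Submodule.add_mem _ (hle (ih x)) (Submodule.smul_mem _ _ hk)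

lemma star_dotProduct_eq_zero_of_mem_span {S : Set (Fin M → ℂ)} {y u : Fin M → ℂ}
    (hS : ∀ h ∈ S, star h ⬝ᵥ y = 0) (hu : u ∈ Submodule.span ℂ S) : star u ⬝ᵥ y = 0 := by
  induction hu using Submodule.span_induction with
  | mem u hu => exact hS u hu
  | zero => simp
  | add u w _ _ hu hw => rw [star_add, add_dotProduct, hu, hw, add_zero]
  | smul c u _ hu => rw [star_smul, smul_dotProduct, hu, smul_zero]

open scoped ComplexOrder in
lemma star_dotProduct_residual (H : Vectors M G g) (L : List (User G g)) (x : Fin M → ℂ) :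
    ∀ k ∈ L, star (H k) ⬝ᵥ residual H L x = 0 := by
  induction L generalizing x with
  | nil => simp
  | cons j L ih =>
    have hL : ∀ k ∈ L, star (H k) ⬝ᵥ residual H (j :: L) x = 0 := by
      intro k hk
      rw [residual, dotProduct_sub, dotProduct_smul, ih x k hk, ih (H j) k hk, smul_zero, sub_zero]
    intro k hk
    rcases List.mem_cons.1 hk with rfl | hk
    · have h1 : star (H k - residual H L (H k)) ⬝ᵥ residual H (k :: L) x = 0 := by
        refine star_dotProduct_eq_zero_of_mem_span ?_ (sub_residual_mem_span H L (H k))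
        rintro _ ⟨m, hm, rfl⟩
        exact hL m hm
      rw [star_sub, sub_dotProduct, sub_eq_zero] at h1
      rw [h1, residual, dotProduct_sub, dotProduct_smul, smul_eq_mul]
      by_cases hw : residual H L (H k) = 0
      · simp [hw]
      · rw [div_mul_cancel₀ _ (mt dotProduct_star_self_eq_zero.1 hw), sub_self]
    · exact hL k hk

lemma measurable_residual (L : List (User G g)) {x : Vectors M G g → Fin M → ℂ}
    (hx : Measurable x) : Measurable fun H : Vectors M G g => residual H L (x H) := by
  induction L generalizing x with
  | nil => exact hx
  | cons k L ih =>
    have h1 := ih hx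
    have h2 := ih (x := fun H => H k) (measurable_pi_apply k)
    have hd : ∀ {u w : Vectors M G g → Fin M → ℂ}, Measurable u → Measurable w →
        Measurable fun H => star (u H) ⬝ᵥ w H := by
      intro u w hu hw
      refine Finset.measurable_sum _ fun a _ => Measurable.mul ?_ ((measurable_pi_apply a).comp hw)
      exact continuous_star.measurable.comp ((measurable_pi_apply a).comp hu)
    exact h1.sub (((hd h2 h1).div (hd h2 h2)).smul h2)

/-- Fewer than `M` vectors of `ℂ^M` have a common orthogonal unit vector that depends measurably on
them. -/
lemma exists_measurable_orthogonal (L : List (User G g)) (hL : L.length < M) :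
    ∃ u : Vectors M G g → Fin M → ℂ, Measurable u ∧ (∀ H, sqNorm (u H) = 1) ∧
      ∀ H, ∀ k ∈ L, star (H k) ⬝ᵥ u H = 0 := by
  classical
  let b : ℕ → Fin M → ℂ := fun n a => if n = a then 1 else 0
  have hex : ∀ H : Vectors M G g, ∃ n, residual H L (b n) ≠ 0 := by
    intro H
    by_contra! hcon
    have hb : ∀ a : Fin M, Pi.single a 1 ∈ Submodule.span ℂ (H '' {k | k ∈ L}) := by
      intro a
      have h1 := sub_residual_mem_span H L (b a)
      rw [hcon, sub_zero] at h1
      convert h1 using 1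
      ext m
      simp [b, Pi.single_apply, Fin.ext_iff, eq_comm]
    have htop : Submodule.span ℂ (H '' {k | k ∈ L}) = ⊤ := by
      rw [eq_top_iff, ← (Pi.basisFun ℂ (Fin M)).span_eq, Submodule.span_le]
      rintro _ ⟨a, rfl⟩
      simpa using hb a
    have h2 := finrank_span_finset_le_card (R := ℂ) (L.toFinset.image H)
    have h3 : ((L.toFinset.image H : Finset (Fin M → ℂ)) : Set (Fin M → ℂ)) =
        H '' {k | k ∈ L} := by
      ext; simp
    rw [Set.finrank, h3, htop, finrank_top, Module.finrank_fin_fun] at h2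
    have h4 := Finset.card_image_le (s := L.toFinset) (f := H)
    have h5 := L.toFinset_card_le
    omega
  have hres : ∀ n, Measurable fun H : Vectors M G g => residual H L (b n) :=
    fun n => measurable_residual L measurable_const
  have hw : Measurable fun H : Vectors M G g => residual H L (b (Nat.find (hex H))) :=
    Measurable.find hres (fun n => hres n (measurableSet_singleton 0).compl) hex
  set w := fun H : Vectors M G g => residual H L (b (Nat.find (hex H))) with hwdef
  have hw0 : ∀ H, 0 < sqNorm (w H) := fun H =>
    (sqNorm_nonneg _).lt_of_ne' (mt sqNorm_eq_zero.1 (Nat.find_spec (hex H)))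
  refine ⟨fun H => (((√(sqNorm (w H)))⁻¹ : ℝ) : ℂ) • w H, ?_, fun H => ?_, fun H k hk => ?_⟩
  · exact (Complex.measurable_ofReal.comp hw.sqNorm.sqrt.inv).smul hw
  · rw [sqNorm_smul, Complex.norm_real, Real.norm_eq_abs, sq_abs, inv_pow,
      Real.sq_sqrt (hw0 H).le, inv_mul_cancel₀ (hw0 H).ne']
  · rw [dotProduct_smul, star_dotProduct_residual H L _ k hk, smul_zero]

/-- A choice of beamforming directions: every group `i` has a unit vector `v Hhat i`, used for all
its streams, which depends measurably on the estimated channels of the users of the other groups and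
is orthogonal to them. -/
structure IsZeroForcingDirection (v : Vectors M G g → Fin G → Fin M → ℂ) : Prop where
  measurable : Measurable v
  sqNorm_eq : ∀ Hhat i, sqNorm (v Hhat i) = 1
  congr : ∀ Hhat Hhat' i, (∀ k : User G g, k.1 ≠ i → Hhat k = Hhat' k) → v Hhat i = v Hhat' i
  orthogonal : ∀ Hhat i (j : User G g), j.1 ≠ i → star (Hhat j) ⬝ᵥ v Hhat i = 0

lemma exists_isZeroForcingDirection {K : ℕ} (hK : K = g * G) (hMK : K - g + 1 ≤ M) :
    ∃ v : Vectors M G g → Fin G → Fin M → ℂ, IsZeroForcingDirection v := by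
  classical
  have hlen : ∀ i : Fin G, (Finset.univ.filter fun k : User G g => k.1 ≠ i).toList.length < M := by
    intro i
    rw [Finset.length_toList, ← Fintype.card_subtype, card_other_groups]
    omega
  choose u hu hu1 huz using fun i => exists_measurable_orthogonal _ (hlen i)
  -- Forgetting the channels of group `i` makes the dependence on the other groups explicit.
  let Z : Fin G → Vectors M G g → Vectors M G g := fun i H k => if k.1 = i then 0 else H k
  have hZ : ∀ i, Measurable (Z i) := fun i => measurable_pi_lambda _ fun k => by
    by_cases h : k.1 = i
    · simp only [Z, h, if_true]; exact measurable_const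
    · simp only [Z, h, if_false]; exact measurable_pi_apply k
  refine ⟨fun H i => u i (Z i H), measurable_pi_lambda _ fun i => (hu i).comp (hZ i),
    fun H i => hu1 i _, fun H H' i h => ?_, fun H i j hj => ?_⟩
  · congr 1
    funext k
    by_cases hk : k.1 = i
    · simp [Z, hk]
    · simp [Z, hk, h k hk]
  · have := huz i (Z i H) j (by simpa using hj)
    simpa only [Z, hj, if_false] using this

/-- With a single group, any fixed direction will do. -/
lemma exists_isZeroForcingDirection_of_subsingleton (hM : 1 ≤ M) [Subsingleton (Fin G)] :
    ∃ v : Vectors M G g → Fin G → Fin M → ℂ, IsZeroForcingDirection v := by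
  classical
  refine ⟨fun _ _ => Pi.single ⟨0, hM⟩ 1, measurable_const, fun _ _ => ?_, fun _ _ _ _ => rfl,
    fun _ i j hj => absurd (Subsingleton.elim _ _) hj⟩
  rw [sqNorm, Finset.sum_eq_single ⟨0, hM⟩] <;> simp +contextual

/-! ### Achievability -/

/-- The exponent of the SNR in the power of the `r`-th stream (counted from `0`) of a group: the
powers increase by the factor `P^{β/g}` from each stream to the next, up to `P`. -/
noncomputable def powerExponent (g : ℕ) (β : ℝ) (r : Fin g) : ℝ :=
  1 - ((g : ℝ) - (((r : ℕ) : ℝ) + 1)) * β / g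

/-- All the streams of a group use the direction of that group, with powers increasing
geometrically. -/
noncomputable def geometricPrecoder (β P : ℝ) (v : Vectors M G g → Fin G → Fin M → ℂ)
    (Hhat : Vectors M G g) : Vectors M G g :=
  fun k => (√(1 / (g * G) * P ^ powerExponent g β k.2) : ℂ) • v Hhat k.1

lemma powerExponent_le_one {β : ℝ} (hβ : 0 ≤ β) (r : Fin g) : powerExponent g β r ≤ 1 := by
  have h1 : ((r : ℕ) : ℝ) + 1 ≤ g := by exact_mod_cast r.2
  have : 0 ≤ ((g : ℝ) - (((r : ℕ) : ℝ) + 1)) * β / g :=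
    div_nonneg (mul_nonneg (by linarith) hβ) (by positivity)
  rw [powerExponent]
  linarith

section Scheme

variable {α β P : ℝ} {v : Vectors M G g → Fin G → Fin M → ℂ}

lemma gain_geometricPrecoder (hP : 1 < P) (h : Fin M → ℂ) (Hhat : Vectors M G g) (k : User G g) :
    gain h (geometricPrecoder β P v Hhat k) =
      1 / (g * G) * P ^ powerExponent g β k.2 * gain h (v Hhat k.1) := by
  rw [geometricPrecoder, gain_smul, norm_sqrt_sq (by positivity)]

lemma sqNorm_geometricPrecoder (hv : IsZeroForcingDirection v) (hP : 1 < P) (Hhat : Vectors M G g)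
    (k : User G g) :
    sqNorm (geometricPrecoder β P v Hhat k) = 1 / (g * G) * P ^ powerExponent g β k.2 := by
  rw [geometricPrecoder, sqNorm_smul, norm_sqrt_sq (by positivity), hv.sqNorm_eq, mul_one]

lemma isScheme_geometricPrecoder (hv : IsZeroForcingDirection v) (hβ : 0 ≤ β) (hG : 0 < G)
    (hg : 0 < g) (hP : 1 < P) : IsScheme P (geometricPrecoder β P v) where
  measurable := measurable_pi_lambda _ fun k =>
    ((measurable_pi_apply k.1).comp hv.measurable).const_smul
      (√(1 / (g * G) * P ^ powerExponent g β k.2) : ℂ)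
  power_le Hhat := by
    have hG0 : (0 : ℝ) < G := by exact_mod_cast hG
    have hg0 : (0 : ℝ) < g := by exact_mod_cast hg
    have h : ∀ k, sqNorm (geometricPrecoder β P v Hhat k) ≤ 1 / (g * G) * P := fun k => by
      rw [sqNorm_geometricPrecoder hv hP]
      gcongr
      simpa using Real.rpow_le_rpow_of_exponent_le hP.le (powerExponent_le_one hβ k.2)
    refine (Finset.sum_le_card_nsmul _ _ _ fun k _ => h k).trans_eq ?_
    simp only [Finset.card_univ, Fintype.card_prod, Fintype.card_fin, nsmul_eq_mul]
    push_cast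
    field_simp

lemma isZeroForcing_geometricPrecoder (hv : IsZeroForcingDirection v)
    (μ : Measure (Vectors M G g)) : IsZeroForcing μ (geometricPrecoder β P v) :=
  Eventually.of_forall fun Hhat k j hjk => by
    rw [geometricPrecoder, dotProduct_smul, hv.orthogonal Hhat k.1 j hjk, smul_zero]

/-- The event that all the users receive the direction of their own group with a power of order one,
while the estimation errors are of the order of `σ_e²`. -/
def goodEvent (α P δ R : ℝ) (v : Vectors M G g → Fin G → Fin M → ℂ) :
    Set (Vectors M G g × Vectors M G g) :=
  {x | ∀ j, δ ≤ gain (x.2 j) (v x.1 j.1) ∧ sqNorm (x.2 j) ≤ R ∧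
    sqNorm (x.2 j - x.1 j) ≤ errVar α P * R}

lemma measurableSet_goodEvent (hv : Measurable v) (δ R : ℝ) :
    MeasurableSet (goodEvent α P δ R v) := by
  have : goodEvent α P δ R v = ⋂ j, {x | δ ≤ gain (x.2 j) (v x.1 j.1) ∧ sqNorm (x.2 j) ≤ R ∧
    sqNorm (x.2 j - x.1 j) ≤ errVar α P * R} := by ext; simp [goodEvent]
  rw [this]
  refine MeasurableSet.iInter fun j => ?_
  have h1 : Measurable fun x : Vectors M G g × Vectors M G g => x.2 j := by fun_prop
  have h2 : Measurable fun x : Vectors M G g × Vectors M G g => x.2 j - x.1 j := by fun_prop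
  have h3 : Measurable fun x : Vectors M G g × Vectors M G g => v x.1 j.1 :=
    (measurable_pi_apply j.1).comp (hv.comp measurable_fst)
  exact (measurableSet_le measurable_const (h1.gain h3)).inter
    ((measurableSet_le h1.sqNorm measurable_const).inter
      (measurableSet_le h2.sqNorm measurable_const))

/-- On the good event, every stream has a signal-to-interference ratio of order `P^{β/g}` at all the
users that decode it. -/
lemma rate_geometricPrecoder_ge (hv : IsZeroForcingDirection v) (hβ0 : 0 ≤ β) (hβ1 : β ≤ 1)
    (hg : 0 < g) (hG : 0 < G) (hP : 1 < P) {δ R : ℝ} (hδ : 0 < δ) (hR : 0 < R)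
    {x : Vectors M G g × Vectors M G g} (hx : x ∈ goodEvent α P δ R v) (j : User G g) (r : Fin g)
    (hI : interInterference x.2 (geometricPrecoder β P v x.1) j ≤ R * P ^ (1 - β)) :
    β / g * Real.logb 2 P + Real.logb 2 (1 / (g * G) * δ / (g * (1 / (g * G) * R) + R + 1)) ≤
      rate x.2 (geometricPrecoder β P v x.1) j (j.1, r) := by
  have hG0 : (0 : ℝ) < G := by exact_mod_cast hG
  have hg0 : (0 : ℝ) < g := by exact_mod_cast hg
  have hP0 : 0 < P := by linarith
  obtain ⟨h1, h2, -⟩ := hx j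
  set c : ℝ := 1 / (g * G) with hc
  have hc0 : 0 < c := by positivity
  set y := gain (x.2 j) (v x.1 j.1)
  have hyR : y ≤ R := (gain_le _ _).trans (by rw [hv.sqNorm_eq, mul_one]; exact h2)
  set E := powerExponent g β r - β / g with hE
  have hE1 : 1 - β ≤ E := by
    have : E = 1 - β + (r : ℕ) * β / g := by
      rw [hE, powerExponent]; field_simp; ring
    rw [this]
    have : 0 ≤ ((r : ℕ) : ℝ) * β / g := by positivity
    linarith
  have hP1 : P ^ (1 - β) ≤ P ^ E := Real.rpow_le_rpow_of_exponent_le hP.le hE1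
  have hP2 : 1 ≤ P ^ E := Real.one_le_rpow hP.le (by linarith)
  have hintra : intraInterference x.2 (geometricPrecoder β P v x.1) j (j.1, r) ≤
      g * (c * R) * P ^ E := by
    rw [intraInterference_eq]
    calc _ ≤ ∑ s with s < r, c * R * P ^ E := by
          refine Finset.sum_le_sum fun s hs => ?_
          have hsr : s < r := (Finset.mem_filter.1 hs).2
          rw [gain_geometricPrecoder hP]
          have hsE : powerExponent g β s ≤ E := by
            have h3 : ((s : ℕ) : ℝ) + 1 ≤ (r : ℕ) := by exact_mod_cast hsr
            have h4 : E - powerExponent g β s = (((r : ℕ) : ℝ) - ((s : ℕ) + 1)) * β / g := by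
              rw [hE, powerExponent, powerExponent]; field_simp; ring
            have h5 : 0 ≤ (((r : ℕ) : ℝ) - ((s : ℕ) + 1)) * β / g :=
              div_nonneg (mul_nonneg (by linarith) hβ0) hg0.le
            linarith
          have h6 : P ^ powerExponent g β s ≤ P ^ E :=
            Real.rpow_le_rpow_of_exponent_le hP.le hsE
          calc c * P ^ powerExponent g β s * y ≤ c * P ^ E * R := by gcongr; exact gain_nonneg _ _
            _ = c * R * P ^ E := by ring
      _ ≤ ∑ _s : Fin g, c * R * P ^ E :=
          Finset.sum_le_sum_of_subset_of_nonneg (Finset.subset_univ _)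
            fun _ _ _ => by positivity
      _ = g * (c * R) * P ^ E := by simp; ring
  have hI0 := interInterference_nonneg x.2 (geometricPrecoder β P v x.1) j
  have hi0 := intraInterference_nonneg x.2 (geometricPrecoder β P v x.1) j (j.1, r)
  have hden : intraInterference x.2 (geometricPrecoder β P v x.1) j (j.1, r) +
      interInterference x.2 (geometricPrecoder β P v x.1) j + 1 ≤
      (g * (c * R) + R + 1) * P ^ E := by
    nlinarith [mul_le_mul_of_nonneg_left hP1 hR.le]
  have hnum : c * δ * (P ^ E * P ^ (β / g)) ≤
      gain (x.2 j) (geometricPrecoder β P v x.1 (j.1, r)) := by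
    rw [gain_geometricPrecoder hP, ← Real.rpow_add hP0, hE, sub_add_cancel]
    have : 0 < P ^ powerExponent g β r := by positivity
    calc c * δ * P ^ powerExponent g β r = c * P ^ powerExponent g β r * δ := by ring
      _ ≤ _ := by gcongr
  have hPE : 0 < P ^ E := by positivity
  have hPβ : 0 < P ^ (β / g) := by positivity
  have hsinr : c * δ / (g * (c * R) + R + 1) * P ^ (β / g) ≤
      gain (x.2 j) (geometricPrecoder β P v x.1 (j.1, r)) /
        (intraInterference x.2 (geometricPrecoder β P v x.1) j (j.1, r) +
          interInterference x.2 (geometricPrecoder β P v x.1) j + 1) := by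
    rw [le_div_iff₀ (by linarith)]
    refine le_trans (mul_le_mul_of_nonneg_left hden (by positivity)) (le_trans (le_of_eq ?_) hnum)
    field_simp
  rw [rate, ← Real.logb_rpow_eq_mul_logb_of_pos hP0,
    ← Real.logb_mul (by positivity) (by positivity)]
  refine Real.logb_le_logb_of_le one_lt_two (by positivity) ?_
  linarith

/-- Zero-forcing leaves an interference from the other groups of the order of `P σ_e²`. -/
lemma interInterference_geometricPrecoder_le (hv : IsZeroForcingDirection v) (hα : 0 ≤ α)
    (hP : 1 < P) {δ R : ℝ} (hR : 0 < R)
    {x : Vectors M G g × Vectors M G g} (hx : x ∈ goodEvent α P δ R v) (j : User G g) :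
    interInterference x.2 (geometricPrecoder α P v x.1) j ≤ R * P ^ (1 - α) := by
  have hG0 : (0 : ℝ) < G := by exact_mod_cast j.1.pos
  have hg0 : (0 : ℝ) < g := by exact_mod_cast j.2.pos
  have hP0 : 0 < P := by linarith
  have hσ := errVar_pos α hP
  obtain ⟨-, -, h3⟩ := hx j
  calc interInterference x.2 (geometricPrecoder α P v x.1) j
      ≤ ∑ m : User G g with m.1 ≠ j.1, 1 / (g * G) * P * (errVar α P * R) := by
        refine Finset.sum_le_sum fun m hm => ?_
        have hmj : m.1 ≠ j.1 := (Finset.mem_filter.1 hm).2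
        have h0 : gain (x.2 j) (v x.1 m.1) = gain (x.2 j - x.1 j) (v x.1 m.1) := by
          rw [gain, gain, star_sub, sub_dotProduct, hv.orthogonal x.1 m.1 j hmj.symm, sub_zero]
        rw [gain_geometricPrecoder hP, h0]
        have h4 : P ^ powerExponent g α m.2 ≤ P := by
          simpa using Real.rpow_le_rpow_of_exponent_le hP.le (powerExponent_le_one hα m.2)
        have h5 : gain (x.2 j - x.1 j) (v x.1 m.1) ≤ errVar α P * R :=
          (gain_le _ _).trans (by rw [hv.sqNorm_eq, mul_one]; exact h3)
        have := gain_nonneg (x.2 j - x.1 j) (v x.1 m.1)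
        gcongr
    _ ≤ ∑ _m : User G g, 1 / (g * G) * P * (errVar α P * R) :=
        Finset.sum_le_sum_of_subset_of_nonneg (Finset.subset_univ _) fun _ _ _ => by positivity
    _ = R * P ^ (1 - α) := by
        simp only [Finset.sum_const, Finset.card_univ, Fintype.card_prod, Fintype.card_fin,
          nsmul_eq_mul, errVar, sub_eq_add_neg, Real.rpow_add hP0, Real.rpow_one]
        push_cast
        field_simp

/-- The minimum over the users may be taken before averaging over the channels. -/
lemma mul_le_mmfRate (J : Measure (Vectors M G g × Vectors M G g)) [IsFiniteMeasure J]
    (p : Vectors M G g → Vectors M G g) {S : Set (Vectors M G g × Vectors M G g)}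
    (hS : MeasurableSet S) {A : ℝ}
    (hA : ∀ x ∈ S, ∀ j : User G g, ∀ r, A ≤ rate x.2 (p x.1) j (j.1, r)) :
    J S * ENNReal.ofReal A ≤ mmfRate J p := by
  have hm : Measurable (S.indicator fun _ => ENNReal.ofReal A) := measurable_const.indicator hS
  rw [mul_comm, ← lintegral_indicator_const hS, ← Measure.lintegral_condKernel hm]
  refine lintegral_mono fun Hhat => le_iInf fun k => le_iInf₂ fun r _ => lintegral_mono fun H => ?_
  by_cases h : (Hhat, H) ∈ S
  · rw [Set.indicator_of_mem h]
    exact ENNReal.ofReal_le_ofReal (hA _ h (k.1, r) k.2)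
  · rw [Set.indicator_of_notMem h]
    exact zero_le

variable {Γ : User G g → ℝ} {ν : ℝ → Measure (Vectors M G g × Vectors M G g)}

lemma exists_gain_direction_lt (hM : 1 ≤ M) (hν : IsFadingModel Γ ν) (α : ℝ)
    (j : User G g) {ε : ℝ≥0∞} (hε : 0 < ε) :
    ∃ δ : ℝ, 0 < δ ∧ ∀ P > 1, ∀ v, IsZeroForcingDirection v →
      ν P {ω | gain ((channelPair α P ω).2 j) (v (channelPair α P ω).1 j.1) < δ} ≤ ε := by
  obtain ⟨δ₁, hδ₁, h₁⟩ := exists_measure_gain_lt hM hν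
    (fun a => (Pi.single j (Pi.single a 1), 0)) hε
  obtain ⟨δ₂, hδ₂, h₂⟩ := exists_measure_gain_lt hM hν
    (fun a => (0, Pi.single j (Pi.single a 1))) hε
  refine ⟨min δ₁ δ₂ / 2, by positivity, fun P hP v hv => ?_⟩
  have hσ := errVar_pos α hP
  have hmx : Measurable fun ω : Vectors M G g × Vectors M G g => (channelPair α P ω).2 j :=
    (measurable_pi_apply j).comp (measurable_snd.comp (measurable_channelPair α P))
  have hmw : Measurable fun ω : Vectors M G g × Vectors M G g => v (channelPair α P ω).1 j.1 :=
    (measurable_pi_apply j.1).comp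
      (hv.measurable.comp (measurable_fst.comp (measurable_channelPair α P)))
  -- Either the estimate or the error carries at least half of the power of the channel.
  rcases le_total (errVar α P) (1 / 2) with hle | hle
  · refine (measure_mono fun ω hω => ?_).trans
      (h₁ P hP _ _ hmx hmw (√(1 - errVar α P)) (Real.sqrt_pos.2 (by linarith))
        (fun ω a z => (channelPair_add_estimate α P ω j a z).2)
        (fun ω a z => hv.congr _ _ _ fun k hk =>
          (channelPair_add_estimate α P ω j a z).1 k fun h => hk (by rw [h])))
    have hω' : gain ((channelPair α P ω).2 j) (v (channelPair α P ω).1 j.1) <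
      min δ₁ δ₂ / 2 := hω
    show gain _ _ < _
    rw [Real.sq_sqrt (by linarith), hv.sqNorm_eq, mul_one]
    have := min_le_left δ₁ δ₂
    nlinarith
  · refine (measure_mono fun ω hω => ?_).trans
      (h₂ P hP _ _ hmx hmw (√(errVar α P)) (Real.sqrt_pos.2 hσ)
        (fun ω a z => (channelPair_add_error α P ω j a z).2)
        (fun ω a z => by simp only [(channelPair_add_error α P ω j a z).1]))
    have hω' : gain ((channelPair α P ω).2 j) (v (channelPair α P ω).1 j.1) <
      min δ₁ δ₂ / 2 := hω
    show gain _ _ < _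
    rw [Real.sq_sqrt hσ.le, hv.sqNorm_eq, mul_one]
    have := min_le_right δ₁ δ₂
    nlinarith

lemma exists_goodEvent_compl_le (hM : 1 ≤ M) (hν : IsFadingModel Γ ν) (hα : 0 ≤ α)
    {ε : ℝ≥0∞} (hε : 0 < ε) :
    ∃ δ R : ℝ, 0 < δ ∧ 0 < R ∧ ∀ P > 1, ∀ v, IsZeroForcingDirection v →
      jointLaw α ν P (goodEvent α P δ R v)ᶜ ≤ ε := by
  have hε2 : 0 < ε / 2 := ENNReal.half_pos hε.ne'
  have hε' : 0 < ε / 2 / (Fintype.card (User G g) : ℝ≥0∞) :=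
    ENNReal.div_pos hε2.ne' (ENNReal.natCast_ne_top _)
  choose δ hδ h using fun j : User G g => exists_gain_direction_lt hM hν α j hε'
  obtain ⟨δ₀, hδ₀, hle⟩ : ∃ δ₀ : ℝ, 0 < δ₀ ∧ ∀ j, δ₀ ≤ δ j := by
    obtain hq | hq := isEmpty_or_nonempty (User G g)
    · exact ⟨1, one_pos, fun q => hq.elim q⟩
    · obtain ⟨q, hq⟩ := Finite.exists_min δ
      exact ⟨δ q, hδ q, hq⟩
  obtain ⟨R, hR, hRP⟩ := exists_energy_bound hν hε2
  refine ⟨δ₀, 2 * R, hδ₀, by positivity, fun P hP v hv => ?_⟩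
  have hσ := errVar_pos α hP
  rw [jointLaw_apply α P (measurableSet_goodEvent hv.measurable _ _).compl]
  calc ν P _ ≤ ν P ((⋃ j, {ω | gain ((channelPair α P ω).2 j)
          (v (channelPair α P ω).1 j.1) < δ j}) ∪ {ω | R < energy ω.1 + energy ω.2}) := by
        refine measure_mono fun ω hω => ?_
        by_contra hcon
        refine hω fun j => ?_
        have h1 : energy ω.1 + energy ω.2 ≤ R := not_lt.1 fun hlt => hcon (Or.inr hlt)
        have h2 : δ j ≤ gain ((channelPair α P ω).2 j) (v (channelPair α P ω).1 j.1) :=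
          not_lt.1 fun hlt => hcon (Or.inl (Set.mem_iUnion.2 ⟨j, hlt⟩))
        have h3 := energy_channelPair_le hα hP ω
        have h4 := sqNorm_le_energy (channelPair α P ω).2 j
        have h5 := sqNorm_le_energy ω.2 j
        have h6 := energy_nonneg ω.1
        refine ⟨(hle j).trans h2, by linarith, ?_⟩
        rw [sqNorm_channelPair_sub hP]
        exact mul_le_mul_of_nonneg_left (by linarith) hσ.le
    _ ≤ ε / 2 + ε / 2 := (measure_union_le _ _).trans
        (add_le_add (measure_iUnion_le_of_le _ _ fun j => h j P hP v hv) (hRP P hP))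
    _ = ε := ENNReal.add_halves ε

/-- The geometric power allocation along zero-forcing directions achieves the gain `β / g`, provided
that the interference from the other groups is of order `P^{1-β}`: this is the case for `β = α`, and
trivially for a single group. -/
lemma exists_le_mmfRate_geometricPrecoder [∀ P, IsProbabilityMeasure (ν P)] (hM : 1 ≤ M)
    (hG : 0 < G) (hg : 0 < g) (hν : IsFadingModel Γ ν) (hα : 0 ≤ α) (hβ0 : 0 ≤ β) (hβ1 : β ≤ 1)
    (hv : IsZeroForcingDirection v)
    (hI : ∀ P > 1, ∀ δ R : ℝ, 0 < R → ∀ x ∈ goodEvent α P δ R v, ∀ j,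
      interInterference x.2 (geometricPrecoder β P v x.1) j ≤ R * P ^ (1 - β))
    {ε : ℝ} (hε : 0 < ε) :
    ∃ C : ℝ, ∀ P > 1, ENNReal.ofReal ((β / g - ε) * Real.logb 2 P - C) ≤
      mmfRate (jointLaw α ν P) (geometricPrecoder β P v) := by
  have hg1 : (1 : ℝ) ≤ g := by exact_mod_cast hg
  set η := min ε 1
  have hη : 0 < η := lt_min hε one_pos
  obtain ⟨δ, R, hδ, hR, h⟩ := exists_goodEvent_compl_le hM hν hα (ENNReal.ofReal_pos.2 hη)
  set t := Real.logb 2 (1 / (g * G) * δ / (g * (1 / (g * G) * R) + R + 1))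
  refine ⟨|t|, fun P hP => ?_⟩
  have hL : 0 < Real.logb 2 P := Real.logb_pos one_lt_two hP
  have hS := measurableSet_goodEvent (α := α) (P := P) hv.measurable δ R
  have hJ : ENNReal.ofReal (1 - η) ≤ jointLaw α ν P (goodEvent α P δ R v) := by
    rw [ENNReal.ofReal_sub _ hη.le, ENNReal.ofReal_one, tsub_le_iff_right,
      ← prob_add_prob_compl (μ := jointLaw α ν P) hS]
    exact add_le_add_right (h P hP v hv) _
  refine le_trans ?_ (mul_le_mmfRate (jointLaw α ν P) _ hS (A := β / g * Real.logb 2 P + t)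
    fun x hx j r => rate_geometricPrecoder_ge hv hβ0 hβ1 hg hG hP hδ hR hx j r
      (hI P hP δ R hR x hx j))
  refine le_trans ?_ (mul_le_mul_left hJ _)
  have hη1 : η ≤ 1 := min_le_right _ _
  have hηε : η ≤ ε := min_le_left _ _
  rw [← ENNReal.ofReal_mul (by linarith)]
  refine ENNReal.ofReal_le_ofReal ?_
  have h1 : β / g ≤ 1 := (div_le_self hβ0 hg1).trans hβ1
  have h2 : 0 ≤ β / g := by positivity
  have h3 : η * (β / g) ≤ ε := by nlinarith
  have h4 : -|t| ≤ (1 - η) * t := by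
    have := neg_abs_le t
    have := abs_nonneg t
    nlinarith
  nlinarith

end Scheme

variable {ν : ℝ → Measure (Vectors M G g × Vectors M G g)}
  [∀ P, IsProbabilityMeasure (ν P)]

/-! ### Multiplexing gains -/

lemma mmfRate_le_optMmfRate (J : Measure (Vectors M G g × Vectors M G g)) [IsFiniteMeasure J]
    {P : ℝ} {p : Vectors M G g → Vectors M G g} (hp : IsScheme P p) :
    mmfRate J p ≤ optMmfRate J P :=
  le_iSup₂ (f := fun p (_ : IsScheme P p) => mmfRate J p) p hp

/-- An upper bound for all schemes and a family of schemes that attains it determine the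
multiplexing gain, which is that of this family. -/
lemma hasMultiplexingGain_of_schemes {α d : ℝ} (hd : 0 ≤ d)
    (hup : ∀ ε > 0, ∃ C : ℝ, ∀ᶠ P in atTop, ∀ p, IsScheme P p →
      mmfRate (jointLaw α ν P) p ≤ ENNReal.ofReal ((d + ε) * Real.logb 2 P + C))
    {p : ℝ → Vectors M G g → Vectors M G g} (hp : ∀ P > 1, IsScheme P (p P))
    (hlow : ∀ ε > 0, ∃ C : ℝ, ∀ P > 1, ENNReal.ofReal ((d - ε) * Real.logb 2 P - C) ≤
      mmfRate (jointLaw α ν P) (p P)) :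
    HasMultiplexingGain (fun P => optMmfRate (jointLaw α ν P) P) d ∧
      HasMultiplexingGain (fun P => mmfRate (jointLaw α ν P) (p P)) d := by
  constructor
  · refine hasMultiplexingGain_of_bounds hd (fun ε hε => ?_) fun ε hε => ?_
    · obtain ⟨C, hC⟩ := hup ε hε
      exact ⟨C, hC.mono fun P h => iSup₂_le h⟩
    · obtain ⟨C, hC⟩ := hlow ε hε
      exact ⟨C, (eventually_gt_atTop 1).mono fun P hP =>
        (hC P hP).trans (mmfRate_le_optMmfRate _ (hp P hP))⟩
  · refine hasMultiplexingGain_of_bounds hd (fun ε hε => ?_) fun ε hε => ?_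
    · obtain ⟨C, hC⟩ := hup ε hε
      exact ⟨C, (hC.and (eventually_gt_atTop 1)).mono fun P h => h.1 _ (hp P h.2)⟩
    · obtain ⟨C, hC⟩ := hlow ε hε
      exact ⟨C, (eventually_gt_atTop 1).mono hC⟩

lemma hasMultiplexingGain_zero {α : ℝ}
    (hup : ∀ ε > 0, ∃ C : ℝ, ∀ᶠ P in atTop, ∀ p, IsScheme P p →
      mmfRate (jointLaw α ν P) p ≤ ENNReal.ofReal (ε * Real.logb 2 P + C)) :
    HasMultiplexingGain (fun P => optMmfRate (jointLaw α ν P) P) 0 := by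
  refine hasMultiplexingGain_of_bounds le_rfl (fun ε hε => ?_) fun ε hε => ⟨0, ?_⟩
  · obtain ⟨C, hC⟩ := hup ε hε
    exact ⟨C, hC.mono fun P h => iSup₂_le (by simpa using h)⟩
  · filter_upwards [eventually_gt_atTop 1] with P hP
    have : (0 - ε) * Real.logb 2 P - 0 ≤ 0 := by
      have := Real.logb_pos one_lt_two hP
      nlinarith
    rw [ENNReal.ofReal_of_nonpos this]
    exact zero_le

end NOMA

theorem proposition4 (M K G g : ℕ) (hM : 1 ≤ M) (hG : 1 ≤ G) (hGK : G < K) (hK : K = g * G)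
    (α : ℝ) (hα0 : 0 ≤ α) (hα1 : α ≤ 1) (Γ : NOMA.User G g → ℝ)
    (ν : ℝ → Measure (NOMA.Vectors M G g × NOMA.Vectors M G g))
    [∀ P, IsProbabilityMeasure (ν P)] (hν : NOMA.IsFadingModel Γ ν) :
    (1 < G → K - g + 1 ≤ M →
      NOMA.HasMultiplexingGain (fun P => NOMA.optMmfRate (NOMA.jointLaw α ν P) P) (α / g) ∧
      ∃ c : ℝ, 0 < c ∧ ∃ p : ℝ → NOMA.Vectors M G g → NOMA.Vectors M G g,
        (∀ P > 1, NOMA.IsScheme P (p P) ∧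
          NOMA.IsZeroForcing (NOMA.jointLaw α ν P).fst (p P) ∧
          ∀ Hhat k, NOMA.sqNorm (p P Hhat k) =
            c * P ^ (1 - ((g : ℝ) - (((k.2 : ℕ) : ℝ) + 1)) * α / g)) ∧
        NOMA.HasMultiplexingGain (fun P => NOMA.mmfRate (NOMA.jointLaw α ν P) (p P)) (α / g)) ∧
    (1 < G → M < K - g + 1 →
      NOMA.HasMultiplexingGain (fun P => NOMA.optMmfRate (NOMA.jointLaw α ν P) P) 0) ∧
    (G = 1 →
      NOMA.HasMultiplexingGain (fun P => NOMA.optMmfRate (NOMA.jointLaw α ν P) P) (1 / K)) := by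
  have hg : 0 < g := Nat.pos_of_ne_zero fun h => by simp [h] at hK; omega
  have hG0 : 0 < G := hG
  have hG0' : (0 : ℝ) < G := by exact_mod_cast hG0
  have hg0' : (0 : ℝ) < g := by exact_mod_cast hg
  refine ⟨fun hG1 hMK => ?_, fun hG1 hMK => ?_, fun hG1 => ?_⟩
  · obtain ⟨v, hv⟩ := NOMA.exists_isZeroForcingDirection (M := M) hK hMK
    have hp : ∀ P > 1, NOMA.IsScheme P (NOMA.geometricPrecoder α P v) := fun P hP =>
      NOMA.isScheme_geometricPrecoder hv hα0 hG0 hg hP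
    obtain ⟨h1, h2⟩ := NOMA.hasMultiplexingGain_of_schemes (ν := ν) (α := α) (d := α / g)
      (by positivity)
      (fun ε hε => (NOMA.exists_mmfRate_le_quality hM hG1 hg hν hα0 hε).imp fun C hC =>
        (eventually_gt_atTop 1).mono hC) hp
      (fun ε hε => NOMA.exists_le_mmfRate_geometricPrecoder hM hG0 hg hν hα0 hα0 hα1 hv
        (fun P hP δ R hR x hx j =>
          NOMA.interInterference_geometricPrecoder_le hv hα0 hP hR hx j) hε)
    exact ⟨h1, 1 / (g * G), by positivity, fun P => NOMA.geometricPrecoder α P v,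
      fun P hP => ⟨hp P hP, NOMA.isZeroForcing_geometricPrecoder hv _,
        fun Hhat k => NOMA.sqNorm_geometricPrecoder hv hP Hhat k⟩, h2⟩
  · refine NOMA.hasMultiplexingGain_zero fun ε hε => ?_
    -- Without any information about the channels, the general bound `α / g` already vanishes.
    rcases hα0.eq_or_lt with rfl | hα
    · exact (NOMA.exists_mmfRate_le_quality hM hG1 hg hν le_rfl hε).imp fun C hC =>
        (eventually_gt_atTop 1).mono fun P hP => by simpa using hC P hP
    · exact NOMA.exists_mmfRate_le_of_few_antennas hM hG0 hg hν hα hK hMK hε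
  · subst hG1
    obtain ⟨v, hv⟩ := NOMA.exists_isZeroForcingDirection_of_subsingleton (G := 1) (g := g) hM
    have hKg : (K : ℝ) = g := by rw [hK, mul_one]
    rw [hKg]
    refine (NOMA.hasMultiplexingGain_of_schemes (by positivity) (fun ε hε => ?_)
      (p := fun P => NOMA.geometricPrecoder 1 P v)
      (fun P hP => NOMA.isScheme_geometricPrecoder hv zero_le_one hG0 hg hP)
      (fun ε hε => NOMA.exists_le_mmfRate_geometricPrecoder hM hG0 hg hν hα0 zero_le_one le_rfl hv
        (fun P hP δ R hR x hx j => ?_) hε)).1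
    · obtain ⟨C, hC⟩ := NOMA.exists_mmfRate_le_single_user hG0 hg hν hα0
      refine ⟨C, (eventually_gt_atTop 1).mono fun P hP p hp => (hC P hP p hp).trans
        (ENNReal.ofReal_le_ofReal ?_)⟩
      have := Real.logb_pos one_lt_two hP
      nlinarith
    · have h0 : NOMA.interInterference x.2 (NOMA.geometricPrecoder 1 P v x.1) j = 0 :=
        Finset.sum_eq_zero fun m hm =>
          absurd (Subsingleton.elim _ _) (Finset.mem_filter.1 hm).2
      rw [h0]
      positivity
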